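/- **Setting.** An instance of HomExtSym consists of natural numbers $n,m$, a list of permutations in $S_n$ generating a group $G\le S_n$, and a partial map $\gamma: G\rightharpoonup S_m$, given by the list of its argument–value pairs. Its solutions are the homomorphisms $\varphi: G\to S_m$ with $\varphi(g)=\gamma(g)$ for all $g\in\operatorname{dom}\gamma$. If $\gamma$ represents a homomorphism $\psi: M\to S_m$ on the subgroup $M=\langle\operatorname{dom}\gamma\rangle$, these are exactly the elements of $\mathrm{HExt}_G(\psi)=\{\varphi\in\mathrm{Hom}(G,S_m):\varphi|_M=\psi\}$. A homomorphism $\varphi$ is output as the list of its values on the given generators. The size of the instance is $N=n+m+s+t$, where $s$ is the number of listed generators and $t$ the number of pairs listed for $\gamma$. (If there are at most $2n$ of each, a bound polynomial in $N$ is a bound polynomial in $n$ and $m$; if $n$ is bounded too, it is polynomial in $m$.) Programs are those of the WHILE language over binary trees with unit cost per elementary operation and an output instruction; numbers are written in unary. For $\psi: M\to S_m$ with $M\le G$, the *subset-sum system* of $\psi$ asks for $\mathsf L:\mathcal V\to\mathbb N$ with $$\sum_{v\in\mathcal V}\mathsf L(v)\,\mathsf F_v(u)=\mathsf K(u)\qquad(u\in\mathcal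 U).$$ Here $\mathcal U$ and $\mathcal V$ are the sets of conjugacy classes of subgroups of index at most $m$ of $M$ and of $G$, respectively; $\mathsf K(u)$ is the number of orbits of the action $\psi$ on $\{1,\dots,m\}$ whose point stabilizers belong to $u$; and for $v=[L]$, $\mathsf F_v(u)$ is the number of double cosets $L\sigma M$ in $G$ with $\sigma^{-1}L\sigma\cap M\in u$. It has one variable for each element of $\mathcal V$ and one constraint for each element of $\mathcal U$. **Theorem (bounded domain).** Let $B\in\mathbb N$. 1. There are a program and a polynomial $p$ such that, on every instance of HomExtSym with $|G|\le B$, the program decides within $p(N)$ steps whether a solution exists, and returns one if so. 2. There are a program and a polynomial $p$ such that, on every instance of HomExtSym with $|G|\le B$, the program outputs all solutions, each exactly once, and halts, with marginal cost at most $p(N)$: at most $p(N)$ steps are made before the first output, between any two consecutive outputs, and after the last output. 3. There is a constant $C$, depending only on $B$, such that for all $n,m$, all $G\le S_n$ with $|G|\le B$, all $M\le G$ and all homomorphisms $\psi: M\to S_m$, the subset-sum system of $\psi$ has at most $C$ variables and at most $C$ constraints. -/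

import Mathlib

namespace HomExt

open Equiv (Perm)

/-! ### A machine model with a step count

Programs of the WHILE language over binary trees. A program transforms one tree. Every elementary
operation (copying a pointer, `nil`, head, tail, building a node, a test for `nil`, entering or
leaving a control structure) is one step, so that a step is a bounded number of pointer
operations. There is no equality test for whole trees and no arithmetic, and running time in this
model agrees with running time on Turing machines up to a polynomial. -/

/-- The data: binary trees without labels. -/
inductive BTree : Type
  | nil : BTree
  | node : BTree → BTree → BTree

namespace BTree

/-- The left subtree; `nil` if there is none. -/
def left : BTree → BTree
  | nil => nil
  | node a _ => a

/-- The right subtree; `nil` if there is none. -/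
def right : BTree → BTree
  | nil => nil
  | node _ b => b

/-- Natural numbers are written in unary. -/
def ofNat : ℕ → BTree
  | 0 => nil
  | k + 1 => node nil (ofNat k)

/-- Lists of trees, as right combs. -/
def ofList : List BTree → BTree
  | [] => nil
  | a :: l => node a (ofList l)

end BTree

/-- Programs. -/
inductive Prog : Type
  /-- return the current tree -/
  | skip : Prog
  /-- return the one-point tree -/
  | nil : Prog
  /-- return the left subtree -/
  | left : Prog
  /-- return the right subtree -/
  | right : Prog
  /-- run both programs on the current tree and join the two results by a node -/
  | pair : Prog → Prog → Prog
  /-- run the first program, then the second on its result -/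
  | seq : Prog → Prog → Prog
  /-- `ite c p q`: run `p` on the current tree if `c` returns a tree other than `nil` on it,
  and `q` if `c` returns `nil` -/
  | ite : Prog → Prog → Prog → Prog
  /-- `loop c p`: as long as `c` does not return `nil` on the current tree, replace the current
  tree by the result of `p` -/
  | loop : Prog → Prog → Prog
  /-- write the current tree to the output, and return it -/
  | emit : Prog

/-- `Runs p x tr y`: started on `x`, the program `p` halts and returns `y`. The list `tr` records
the steps of the run in their order: `some z` is a step that writes `z` to the output, and `none`
is any other step. -/
inductive Runs : Prog → BTree → List (Option BTree) → BTree → Prop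
  | skip (x : BTree) : Runs .skip x [none] x
  | nil (x : BTree) : Runs .nil x [none] .nil
  | left (x : BTree) : Runs .left x [none] x.left
  | right (x : BTree) : Runs .right x [none] x.right
  | pair {p q : Prog} {x y z : BTree} {s t : List (Option BTree)} :
      Runs p x s y → Runs q x t z → Runs (.pair p q) x (none :: (s ++ t)) (.node y z)
  | seq {p q : Prog} {x y z : BTree} {s t : List (Option BTree)} :
      Runs p x s y → Runs q y t z → Runs (.seq p q) x (none :: (s ++ t)) z
  | ite_node {c p q : Prog} {x a b y : BTree} {s t : List (Option BTree)} :
      Runs c x s (.node a b) → Runs p x t y → Runs (.ite c p q) x (none :: (s ++ t)) y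
  | ite_nil {c p q : Prog} {x y : BTree} {s t : List (Option BTree)} :
      Runs c x s .nil → Runs q x t y → Runs (.ite c p q) x (none :: (s ++ t)) y
  | loop_stop {c p : Prog} {x : BTree} {s : List (Option BTree)} :
      Runs c x s .nil → Runs (.loop c p) x (none :: s) x
  | loop_step {c p : Prog} {x a b y z : BTree} {s t u : List (Option BTree)} :
      Runs c x s (.node a b) → Runs p x t y → Runs (.loop c p) y u z →
      Runs (.loop c p) x (none :: (s ++ (t ++ u))) z
  | emit (x : BTree) : Runs .emit x [some x] x

/-- A program has at most one halting run on each input. -/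
theorem Runs.deterministic {p : Prog} {x y y' : BTree} {s s' : List (Option BTree)}
    (h : Runs p x s y) (h' : Runs p x s' y') : s = s' ∧ y = y' := by
  induction h generalizing s' y' with
  | skip | nil | left | right | emit => cases h'; exact ⟨rfl, rfl⟩
  | pair _ _ ih₁ ih₂ =>
    cases h' with
    | pair k₁ k₂ =>
      obtain ⟨rfl, rfl⟩ := ih₁ k₁
      obtain ⟨rfl, rfl⟩ := ih₂ k₂
      exact ⟨rfl, rfl⟩
  | seq _ _ ih₁ ih₂ =>
    cases h' with
    | seq k₁ k₂ =>
      obtain ⟨rfl, rfl⟩ := ih₁ k₁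
      obtain ⟨rfl, rfl⟩ := ih₂ k₂
      exact ⟨rfl, rfl⟩
  | ite_node _ _ ih₁ ih₂ =>
    cases h' with
    | ite_node k₁ k₂ =>
      obtain ⟨rfl, _⟩ := ih₁ k₁
      obtain ⟨rfl, rfl⟩ := ih₂ k₂
      exact ⟨rfl, rfl⟩
    | ite_nil k₁ _ => exact absurd (ih₁ k₁).2 (by simp)
  | ite_nil _ _ ih₁ ih₂ =>
    cases h' with
    | ite_nil k₁ k₂ =>
      obtain ⟨rfl, _⟩ := ih₁ k₁
      obtain ⟨rfl, rfl⟩ := ih₂ k₂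
      exact ⟨rfl, rfl⟩
    | ite_node k₁ _ => exact absurd (ih₁ k₁).2 (by simp)
  | loop_stop _ ih =>
    cases h' with
    | loop_stop k => exact ⟨by rw [(ih k).1], rfl⟩
    | loop_step k _ _ => exact absurd (ih k).2 (by simp)
  | loop_step _ _ _ ih₁ ih₂ ih₃ =>
    cases h' with
    | loop_stop k => exact absurd (ih₁ k).2 (by simp)
    | loop_step k₁ k₂ k₃ =>
      obtain ⟨rfl, _⟩ := ih₁ k₁
      obtain ⟨rfl, rfl⟩ := ih₂ k₂
      obtain ⟨rfl, rfl⟩ := ih₃ k₃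
      exact ⟨rfl, rfl⟩

/-! ### The homomorphism extension problem for permutation groups and codomain `S_m` -/

/-- `HExt ψ` is the set of extensions to `G` of a homomorphism `ψ : M → S_m`, `M ≤ G`. -/
def HExt {G : Type*} [Group G] {M : Subgroup G} {m : ℕ} (ψ : M →* Perm (Fin m)) :
    Set (G →* Perm (Fin m)) :=
  {φ | φ.comp M.subtype = ψ}

/-- An instance: a list of permutations of degree `n` (generating a group `G`), a degree `m`, and
a partial map from `G` to `S_m`, given by the list of its argument-value pairs. -/
structure Instance where
  n : ℕ
  m : ℕ
  gens : List (Perm (Fin n))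
  graph : List (Perm (Fin n) × Perm (Fin m))
  dom_mem : ∀ p ∈ graph, p.1 ∈ Subgroup.closure {g | g ∈ gens}
  single_valued : ∀ p ∈ graph, ∀ q ∈ graph, p.1 = q.1 → p.2 = q.2

namespace Instance

variable (I : Instance)

/-- The domain group `G ≤ S_n`. -/
abbrev G : Subgroup (Perm (Fin I.n)) := Subgroup.closure {g | g ∈ I.gens}

/-- The subgroup `M` of `G` generated by the domain of the partial map. -/
abbrev M : Subgroup I.G := Subgroup.closure {g | ∃ p ∈ I.graph, p.1 = (g : Perm (Fin I.n))}

/-- The solutions: the homomorphisms `G → S_m` that extend the partial map. -/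
def solutions : Set (I.G →* Perm (Fin I.m)) :=
  {φ | ∀ p, ∀ hp : p ∈ I.graph, φ ⟨p.1, I.dom_mem p hp⟩ = p.2}

/-- If the partial map represents a homomorphism `ψ : M → S_m`, then the solutions are the
extensions of `ψ`. -/
theorem solutions_eq_hExt (ψ : I.M →* Perm (Fin I.m))
    (hψ : ∀ p, ∀ hp : p ∈ I.graph,
      ψ ⟨⟨p.1, I.dom_mem p hp⟩, Subgroup.subset_closure ⟨p, hp, rfl⟩⟩ = p.2) :
    I.solutions = HExt ψ := by
  ext φ
  constructor
  · intro h
    refine MonoidHom.eq_of_eqOn_dense (s := ((↑) : I.M → I.G) ⁻¹' {g | ∃ p ∈ I.graph,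
      p.1 = (g : Perm (Fin I.n))}) (Subgroup.closure_closure_coe_preimage) ?_
    rintro ⟨⟨g, hg⟩, hM⟩ ⟨p, hp, rfl⟩
    exact (h p hp).trans (hψ p hp).symm
  · intro h p hp
    rw [← hψ p hp, ← (show φ.comp I.M.subtype = ψ from h)]
    rfl

/-- The parameter in which running times are measured: the two degrees plus the lengths of the
two lists. -/
def size : ℕ := I.n + I.m + I.gens.length + I.graph.length

/-- A permutation is written as the list of its values. -/
def encodePerm {k : ℕ} (σ : Perm (Fin k)) : BTree :=
  .ofList (List.ofFn fun i => .ofNat (σ i))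

/-- The input of the machine. -/
def encode : BTree :=
  .ofList [.ofNat I.n, .ofNat I.m, .ofList (I.gens.map encodePerm),
    .ofList (I.graph.map fun p => .node (encodePerm p.1) (encodePerm p.2))]

/-- A homomorphism from `G` is written as the list of its values on the given generators. -/
def encodeHom (φ : I.G →* Perm (Fin I.m)) : BTree :=
  .ofList (I.gens.attach.map fun g => encodePerm (φ ⟨g.1, Subgroup.subset_closure g.2⟩))

end Instance

/-- `P` solves the search problem (and so the decision problem) for the instance `I` in at most
`T` steps: it returns `nil` if there is no solution, and `node x nil`, where `x` is the code of a
solution, if there is one. -/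
def SolvesSearch (P : Prog) (I : Instance) (T : ℕ) : Prop :=
  ∃ tr y, Runs P I.encode tr y ∧ tr.length ≤ T ∧
    ((I.solutions = ∅ ∧ y = .nil) ∨ ∃ φ ∈ I.solutions, y = .node (I.encodeHom φ) .nil)

/-- `P` enumerates the solutions of `I` with marginal cost at most `T`: the outputs of its run are
the codes of the solutions, each solution once, and never more than `T` consecutive steps are made
without an output (before the first output, between two outputs, or after the last one). -/
def Enumerates (P : Prog) (I : Instance) (T : ℕ) : Prop :=
  ∃ tr y, Runs P I.encode tr y ∧
    (∃ l : List (I.G →* Perm (Fin I.m)), l.Nodup ∧ (∀ φ, φ ∈ l ↔ φ ∈ I.solutions) ∧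
      tr.reduceOption = l.map I.encodeHom) ∧
    ∀ k, List.replicate k none <:+: tr → k ≤ T

/-! ### The subset-sum system of a homomorphism `M → S_m` -/

/-- An instance of multi-dimensional subset sum with repetitions: a multiset `target` in the
finite universe `U`, and a family of multisets in `U` with the finite index set `V`. -/
structure MultiSSR where
  U : Type
  V : Type
  finite_U : Finite U
  finite_V : Finite V
  target : U → ℕ
  family : V → U → ℕ

namespace MultiSSR

/-- The solutions: multiplicities for the members of the family such that the multisets sum to
the target. There is one variable `L v` for each `v : V` and one equation for each `u : U`. -/
def subSum (S : MultiSSR) : Set (S.V → ℕ) :=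
  {L | ∀ u, ∑ᶠ v, L v * S.family v u = S.target u}

/-- The number of variables. -/
noncomputable def numVariables (S : MultiSSR) : ℕ := Nat.card S.V

/-- The number of constraints. -/
noncomputable def numConstraints (S : MultiSSR) : ℕ := Nat.card S.U

end MultiSSR

/-- Conjugacy in `G` of subgroups of index at most `m`. -/
def conjSetoid (G : Type*) [Group G] (m : ℕ) : Setoid {L : Subgroup G // L.index ≤ m} where
  r L₁ L₂ := ∃ g : G, L₁.1.map (MulAut.conj g).toMonoidHom = L₂.1
  iseqv :=
    { refl := fun L => ⟨1, by ext; simp⟩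
      symm := by
        rintro L₁ L₂ ⟨g, h⟩
        refine ⟨g⁻¹, ?_⟩
        rw [← h, Subgroup.map_map]
        ext x
        simp [mul_assoc]
      trans := by
        rintro L₁ L₂ L₃ ⟨g, h⟩ ⟨k, h'⟩
        refine ⟨k * g, ?_⟩
        rw [← h', ← h, Subgroup.map_map]
        congr 1
        ext x
        simp [mul_assoc] }

/-- The set of conjugacy classes of subgroups of index at most `m` of the group `G`. -/
abbrev ConjLE (G : Type*) [Group G] (m : ℕ) : Type _ := Quotient (conjSetoid G m)

/-- The stabilizer in `M` of the point `x` under the action `ψ`. -/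
def pointStabilizer {M : Type*} [Group M] {m : ℕ} (ψ : M →* Perm (Fin m)) (x : Fin m) :
    Subgroup M :=
  (MulAction.stabilizer (Perm (Fin m)) x).comap ψ

theorem relIndex_le_index {M : Type*} [Group M] (H K : Subgroup M) (h : H.index ≠ 0) :
    H.relIndex K ≤ H.index := by
  rw [← Subgroup.relIndex_top_right] at h ⊢
  exact Subgroup.relIndex_le_of_le_right le_top h

theorem index_pointStabilizer_le {M : Type*} [Group M] {m : ℕ} (ψ : M →* Perm (Fin m))
    (x : Fin m) : (pointStabilizer ψ x).index ≤ m := by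
  have h : (MulAction.stabilizer (Perm (Fin m)) x).index ≤ m := by
    rw [MulAction.index_stabilizer]
    simpa using Set.ncard_le_card (MulAction.orbit (Perm (Fin m)) x)
  rw [pointStabilizer, Subgroup.index_comap]
  exact (relIndex_le_index _ _ Subgroup.index_ne_zero_of_finite).trans h

/-- The subgroup `σ⁻¹ L σ ∩ M` of `M`. -/
def conjInter {G : Type*} [Group G] (M L : Subgroup G) (σ : G) : Subgroup M :=
  (L.map (MulAut.conj σ⁻¹).toMonoidHom).subgroupOf M

theorem index_conjInter_le {G : Type*} [Group G] [Finite G] (M L : Subgroup G) (σ : G) {m : ℕ}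
    (hL : L.index ≤ m) : (conjInter M L σ).index ≤ m := by
  have h : (L.map (MulAut.conj σ⁻¹).toMonoidHom).index = L.index :=
    Subgroup.index_map_equiv L (MulAut.conj σ⁻¹)
  refine le_trans ?_ hL
  rw [← h]
  exact relIndex_le_index _ _ Subgroup.index_ne_zero_of_finite

/-- The subset-sum system of `ψ : M → S_m`, `M ≤ G`. The universe is the set of conjugacy classes
of subgroups of `M` of index at most `m`. The target is the multiset of the classes of point
stabilizers, one for each orbit of `ψ`. The index set of the family is the set of conjugacy
classes of subgroups of `G` of index at most `m`, and the member with index `[L]` is the multiset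
of the classes of `σ⁻¹ L σ ∩ M`, one for each double coset `L σ M`. (Other representatives of
orbits, double cosets and classes give the same multisets.) -/
noncomputable def oms {G : Type} [Group G] [Finite G] {M : Subgroup G} {m : ℕ}
    (ψ : M →* Perm (Fin m)) : MultiSSR where
  U := ConjLE M m
  V := ConjLE G m
  finite_U := inferInstance
  finite_V := inferInstance
  target u := Nat.card {ω : MulAction.orbitRel.Quotient ψ.range (Fin m) //
    Quotient.mk (conjSetoid M m)
      ⟨pointStabilizer ψ (Quotient.out ω), index_pointStabilizer_le ψ _⟩ = u}
  family v u := Nat.card {d : DoubleCoset.Quotient ((Quotient.out v).1 : Set G) (M : Set G) //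
    Quotient.mk (conjSetoid M m)
      ⟨conjInter M (Quotient.out v).1 (Quotient.out d),
        index_conjInter_le M _ _ (Quotient.out v).2⟩ = u}

end HomExt

/-!
Parts 1 and 2 rest on one search tree. A solution `φ` makes the points `1, …, m` a `G`-set, and it is
built up orbit by orbit: a partial solution is a list of orbit maps `g ↦ φ g x` with disjoint images
that are compatible with the partial map, and a child of it adds an orbit through the least point
that remains. Each solution below a node lies below exactly one child (`exists_isChild`,
`IsChild.unique`), and a node without remaining points determines its solution
(`sols_subsingleton`).

Whether a node has a solution below it can be decided by counting. The set of remaining points is an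
`M`-set, and a completion exists if and only if this `M`-set is the restriction of a `G`-set. Finite
`M`-sets are isomorphic if every subgroup is the stabilizer of equally many points in both
(`exists_equiv_of_card_stabilizer_eq`), so that it is enough to choose multiplicities for the
transitive `G`-sets such that these numbers agree; this is the subset-sum system. The criterion is
`Viable`, and `viable_of_mem_sols` and `exists_mem_sols` prove that it is correct. For `|G| ≤ B` there
are at most `2 ^ B` unknowns with values at most `m`, so that all choices can be tried in polynomial
time.

The search problem is solved by a descent along viable nodes. For the enumeration the tree is searched
depth first, with an explicit stack of viable nodes. As there is a solution below each of them, and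
as the depth is at most `m`, there are at most `m + 1` rounds between two outputs
(`DfsSpec.exists_trace`). A round replaces only the top of the stack, in a number of steps that does
not depend on the rest of it.

The programs are obtained by a calculus. `PolyTime e f` says that one program computes `f c` from
`e c` in polynomial time, for all `c` in a context, and contexts are extended by bound variables. The
class is closed under folds over lists of polynomial length with polynomially bounded values
(`PolyTime.foldl_of_bound`). This yields quantifiers and counting over types whose elements can be
listed, among them the function types with a domain of bounded size (`PolyTime.elems_fun`), and so
all formulas in the definition of `Viable` translate into programs.

Part 3 holds since a group of order at most `B` has at most `2 ^ B` subsets.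
-/

namespace HomExt

open Equiv (Perm)

/-! ### Functions computed in polynomial time -/

/-- The number of nodes, leaves included. -/
def BTree.size : BTree → ℕ
  | .nil => 1
  | .node a b => a.size + b.size + 1

theorem BTree.size_node (a b : BTree) : (BTree.node a b).size = a.size + b.size + 1 := rfl

/-- The program `P` halts on `x` after `k` steps without any output, and returns `y`. -/
def RunsIn (P : Prog) (x : BTree) (k : ℕ) (y : BTree) : Prop :=
  Runs P x (List.replicate k none) y

namespace RunsIn

theorem skip (x : BTree) : RunsIn .skip x 1 x := Runs.skip x
theorem nil (x : BTree) : RunsIn .nil x 1 .nil := Runs.nil x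
theorem left (x : BTree) : RunsIn .left x 1 x.left := Runs.left x
theorem right (x : BTree) : RunsIn .right x 1 x.right := Runs.right x

theorem pair {p q : Prog} {x y z : BTree} {k l : ℕ} (h : RunsIn p x k y) (h' : RunsIn q x l z) :
    RunsIn (.pair p q) x (k + l + 1) (.node y z) := by
  have := Runs.pair h h'
  rwa [← List.replicate_add, ← List.replicate_succ] at this

theorem seq {p q : Prog} {x y z : BTree} {k l : ℕ} (h : RunsIn p x k y) (h' : RunsIn q y l z) :
    RunsIn (.seq p q) x (k + l + 1) z := by
  have := Runs.seq h h'
  rwa [← List.replicate_add, ← List.replicate_succ] at this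

theorem ite_node {c p q : Prog} {x a b y : BTree} {k l : ℕ} (h : RunsIn c x k (.node a b))
    (h' : RunsIn p x l y) : RunsIn (.ite c p q) x (k + l + 1) y := by
  have := Runs.ite_node (q := q) h h'
  rwa [← List.replicate_add, ← List.replicate_succ] at this

theorem ite_nil {c p q : Prog} {x y : BTree} {k l : ℕ} (h : RunsIn c x k .nil)
    (h' : RunsIn q x l y) : RunsIn (.ite c p q) x (k + l + 1) y := by
  have := Runs.ite_nil (p := p) h h'
  rwa [← List.replicate_add, ← List.replicate_succ] at this

theorem loop_nil {c p : Prog} {x : BTree} {k : ℕ} (h : RunsIn c x k .nil) :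
    RunsIn (.loop c p) x (k + 1) x := by
  rw [RunsIn, List.replicate_succ]
  constructor
  exact h

theorem loop_step {c p : Prog} {x a b y z : BTree} {k l j : ℕ} (h : RunsIn c x k (.node a b))
    (h' : RunsIn p x l y) (h'' : RunsIn (.loop c p) y j z) :
    RunsIn (.loop c p) x (k + (l + j) + 1) z := by
  have := Runs.loop_step h h' h''
  rwa [← List.replicate_add, ← List.replicate_add, ← List.replicate_succ] at this

theorem congr {p : Prog} {x y : BTree} {k l : ℕ} (h : RunsIn p x k y) (hk : k = l) :
    RunsIn p x l y := hk ▸ h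

end RunsIn

theorem eval_mono (p : Polynomial ℕ) : Monotone fun n : ℕ => p.eval n := by
  intro a b hab
  induction p using Polynomial.induction_on' with
  | add p q hp hq => simpa using add_le_add hp hq
  | monomial n c => simpa using Nat.mul_le_mul_left c (Nat.pow_le_pow_left hab n)

/-- A single program computes `f c` from `e c`, for all `c`, without output and in polynomial
time; the size of the result is also polynomially bounded. The index set `Γ` plays the role of a
context, and `e` describes how the variables of the context are presented to the program. -/
def PolyTime {Γ : Type} (e f : Γ → BTree) : Prop :=
  ∃ (P : Prog) (p : Polynomial ℕ), ∀ c, ∃ k, RunsIn P (e c) k (f c) ∧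
    k + (f c).size ≤ p.eval (e c).size

/-- A type whose elements are written as trees. -/
class Coded (α : Type) where
  code : α → BTree
  code_injective : Function.Injective code

open Coded (code code_injective)

/-- The context `Γ` extended by a variable of type `α`. -/
def ext {Γ : Type} (e : Γ → BTree) (α : Γ → Type) [∀ c, Coded (α c)] : (Σ c, α c) → BTree :=
  fun p => .node (e p.1) (code p.2)

namespace PolyTime

variable {Γ : Type} {e f g : Γ → BTree}

theorem of_eq (h : PolyTime e f) (hfg : ∀ c, f c = g c) : PolyTime e g := by
  rwa [← funext hfg]

theorem id (e : Γ → BTree) : PolyTime e e :=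
  ⟨.skip, 1 + Polynomial.X, fun c => ⟨1, .skip _, by simp⟩⟩

theorem comp (h : PolyTime e f) (h' : PolyTime f g) : PolyTime e g := by
  obtain ⟨P, p, hP⟩ := h
  obtain ⟨Q, q, hQ⟩ := h'
  refine ⟨.seq P Q, p + q.comp p + 1, fun c => ?_⟩
  obtain ⟨k, hk, hk'⟩ := hP c
  obtain ⟨l, hl, hl'⟩ := hQ c
  refine ⟨_, hk.seq hl, ?_⟩
  have := eval_mono q (show (f c).size ≤ p.eval (e c).size by omega)
  simp only [Polynomial.eval_add, Polynomial.eval_comp, Polynomial.eval_one] at this ⊢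
  omega

theorem nil : PolyTime e fun _ => .nil :=
  ⟨.nil, 2, fun c => ⟨1, .nil _, by simp [BTree.size]⟩⟩

theorem left (h : PolyTime e f) : PolyTime e fun c => (f c).left := by
  refine h.comp ⟨.left, 1 + Polynomial.X, fun c => ⟨1, .left _, ?_⟩⟩
  have : (f c).left.size ≤ (f c).size := by
    cases f c with
    | nil => exact le_rfl
    | node a b => simp only [BTree.left, BTree.size]; omega
  simpa using this

theorem right (h : PolyTime e f) : PolyTime e fun c => (f c).right := by
  refine h.comp ⟨.right, 1 + Polynomial.X, fun c => ⟨1, .right _, ?_⟩⟩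
  have : (f c).right.size ≤ (f c).size := by
    cases f c with
    | nil => exact le_rfl
    | node a b => simp only [BTree.right, BTree.size]; omega
  simpa using this

theorem node (h : PolyTime e f) (h' : PolyTime e g) : PolyTime e fun c => .node (f c) (g c) := by
  obtain ⟨P, p, hP⟩ := h
  obtain ⟨Q, q, hQ⟩ := h'
  refine ⟨.pair P Q, p + q + 2, fun c => ?_⟩
  obtain ⟨k, hk, hk'⟩ := hP c
  obtain ⟨l, hl, hl'⟩ := hQ c
  refine ⟨_, hk.pair hl, ?_⟩
  simp only [Polynomial.eval_add, BTree.size_node, Polynomial.eval_ofNat]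
  omega

theorem const (x : BTree) : PolyTime e fun _ => x := by
  induction x with
  | nil => exact nil
  | node a b ha hb => exact ha.node hb

theorem restrict {Δ : Type} (r : Δ → Γ) (h : PolyTime e f) :
    PolyTime (fun d => e (r d)) fun d => f (r d) := by
  obtain ⟨P, p, hP⟩ := h
  exact ⟨P, p, fun c => hP (r c)⟩

/-- Truth values are written as `node nil nil` and `nil`. -/
noncomputable instance : Coded Prop where
  code P := open Classical in if P then .node .nil .nil else .nil
  code_injective P Q h := by
    by_cases hP : P <;> by_cases hQ : Q <;> simp_all

theorem code_true : code True = .node .nil .nil := if_pos trivial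
theorem code_false : code False = .nil := if_neg _root_.id

/-- A test divides the context into two parts, on which different programs may be used. -/
theorem cases {P : Γ → Prop} (hP : PolyTime e fun c => code (P c))
    (h : PolyTime (fun c : {c // P c} => e c) fun c => f c)
    (h' : PolyTime (fun c : {c // ¬ P c} => e c) fun c => f c) : PolyTime e f := by
  obtain ⟨R, r, hR⟩ := hP
  obtain ⟨S, s, hS⟩ := h
  obtain ⟨T, t, hT⟩ := h'
  refine ⟨.ite R S T, r + s + t + 1, fun c => ?_⟩
  obtain ⟨k, hk, hk'⟩ := hR c
  simp only [Polynomial.eval_add, Polynomial.eval_one]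
  dsimp only at hk hk'
  by_cases hc : P c
  · obtain ⟨l, hl, hl'⟩ := hS ⟨c, hc⟩
    dsimp only at hl hl'
    rw [eq_true hc, code_true] at hk
    exact ⟨_, hk.ite_node hl, by omega⟩
  · obtain ⟨l, hl, hl'⟩ := hT ⟨c, hc⟩
    dsimp only at hl hl'
    rw [eq_false hc, code_false] at hk
    exact ⟨_, hk.ite_nil hl, by omega⟩

theorem ite {P : Γ → Prop} [∀ c, Decidable (P c)] (hP : PolyTime e fun c => code (P c))
    (h : PolyTime e f) (h' : PolyTime e g) : PolyTime e fun c => if P c then f c else g c :=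
  cases hP ((h.restrict Subtype.val).of_eq fun c => (if_pos c.2).symm)
    ((h'.restrict Subtype.val).of_eq fun c => (if_neg c.2).symm)

variable {α β : Γ → Type} [∀ c, Coded (α c)] [∀ c, Coded (β c)]

/-- Weakening: a program for a context can be used in an extended context. -/
theorem wk (h : PolyTime e f) : PolyTime (ext e α) fun p => f p.1 :=
  PolyTime.comp (f := fun p : Σ c, α c => e p.1) (PolyTime.left (id (ext e α)))
    (h.restrict Sigma.fst)

/-- The last variable of the context; `v1` to `v4` are the variables before it. -/
theorem v0 : PolyTime (ext e α) fun p => code p.2 := PolyTime.right (id (ext e α))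

theorem v1 {β : (Σ c, α c) → Type} [∀ c, Coded (β c)] :
    PolyTime (ext (ext e α) β) fun p => code p.1.2 := wk v0

theorem v2 {β : (Σ c, α c) → Type} [∀ c, Coded (β c)] {γ : (Σ c, β c) → Type}
    [∀ c, Coded (γ c)] : PolyTime (ext (ext (ext e α) β) γ) fun p => code p.1.1.2 := wk v1

theorem v3 {β : (Σ c, α c) → Type} [∀ c, Coded (β c)] {γ : (Σ c, β c) → Type}
    [∀ c, Coded (γ c)] {δ : (Σ c, γ c) → Type} [∀ c, Coded (δ c)] :
    PolyTime (ext (ext (ext (ext e α) β) γ) δ) fun p => code p.1.1.1.2 := wk v2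

theorem v4 {β : (Σ c, α c) → Type} [∀ c, Coded (β c)] {γ : (Σ c, β c) → Type}
    [∀ c, Coded (γ c)] {δ : (Σ c, γ c) → Type} [∀ c, Coded (δ c)] {ε : (Σ c, δ c) → Type}
    [∀ c, Coded (ε c)] :
    PolyTime (ext (ext (ext (ext (ext e α) β) γ) δ) ε) fun p => code p.1.1.1.1.2 := wk v3

theorem bound (h : PolyTime e f) : ∃ p : Polynomial ℕ, ∀ c, (f c).size ≤ p.eval (e c).size := by
  obtain ⟨P, p, hP⟩ := h
  exact ⟨p, fun c => by obtain ⟨k, -, hk⟩ := hP c; omega⟩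

end PolyTime

/-! ### Loops over lists -/

instance {α : Type} [Coded α] : Coded (List α) where
  code l := .ofList (l.map code)
  code_injective l l' h := by
    induction l generalizing l' with
    | nil => cases l' <;> simp_all [BTree.ofList]
    | cons a l ih =>
      cases l' with
      | nil => simp [BTree.ofList] at h
      | cons b l' =>
        simp only [List.map_cons, BTree.ofList, BTree.node.injEq] at h
        rw [code_injective h.1, @ih _ h.2]

theorem code_nil {α : Type} [Coded α] : code ([] : List α) = .nil := rfl

theorem code_cons {α : Type} [Coded α] (a : α) (l : List α) :
    code (a :: l) = .node (code a) (code l) := rfl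

theorem length_lt_size_code {α : Type} [Coded α] (l : List α) : l.length < (code l).size := by
  induction l with
  | nil => exact Nat.one_pos
  | cons a l ih =>
    rw [code_cons, BTree.size_node, List.length_cons]
    omega

theorem size_code_lt_of_mem {α : Type} [Coded α] {l : List α} {a : α} (h : a ∈ l) :
    (code a).size < (code l).size := by
  induction l with
  | nil => simp at h
  | cons b l ih =>
    rw [code_cons, BTree.size_node]
    rcases List.mem_cons.1 h with rfl | h
    · omega
    · have := ih h
      omega

theorem size_code_append {α : Type} [Coded α] (l l' : List α) :
    (code (l ++ l')).size + 1 = (code l).size + (code l').size := by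
  induction l with
  | nil => rw [List.nil_append, code_nil, BTree.size]; omega
  | cons a l ih =>
    rw [List.cons_append, code_cons, code_cons, BTree.size_node, BTree.size_node]
    omega

/-- On a state `node x (node s l)`, where `l` is a list, replace `s` by the result of `S` on
`node (node x s) b` for each entry `b` of `l`. -/
def foldLoop (S : Prog) : Prog :=
  .loop (.seq .right .right) (.pair .left (.pair
    (.seq (.pair (.pair .left (.seq .right .left)) (.seq .right (.seq .right .left))) S)
    (.seq .right (.seq .right .right))))

/-- `T` bounds the steps for a single entry; only the values that occur in the fold matter. -/
theorem foldLoop_run {σ β : Type} [Coded σ] [Coded β] {S : Prog} {x : BTree}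
    {step : σ → β → σ} {T : ℕ} (l : List β) (s : σ)
    (h : ∀ l₁ b l₂, l = l₁ ++ b :: l₂ → ∃ k ≤ T, RunsIn S
      (.node (.node x (code (l₁.foldl step s))) (code b)) k (code (step (l₁.foldl step s) b))) :
    ∃ k ≤ (l.length + 1) * (T + 24), RunsIn (foldLoop S) (.node x (.node (code s) (code l))) k
      (.node x (.node (code (l.foldl step s)) .nil)) := by
  induction l generalizing s with
  | nil =>
    exact ⟨4, by simp only [List.length_nil]; omega,
      .loop_nil ((RunsIn.right _).seq (.right _))⟩
  | cons b l ih =>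
    obtain ⟨k, hk, hS⟩ := h [] b l rfl
    obtain ⟨j, hj, hl⟩ := ih (step s b) fun l₁ b' l₂ hl => h (b :: l₁) b' l₂ (by rw [hl]; rfl)
    refine ⟨_, ?_, RunsIn.loop_step (a := code b) (b := code l) ((RunsIn.right _).seq (.right _))
      (.pair (.left _) (.pair (.seq (.pair (.pair (.left _) ((RunsIn.right _).seq (.left _)))
        ((RunsIn.right _).seq ((RunsIn.right _).seq (.left _)))) hS)
        ((RunsIn.right _).seq ((RunsIn.right _).seq (.right _))))) hl⟩
    have : ((b :: l).length + 1) * (T + 24) = (T + 24) + (l.length + 1) * (T + 24) := by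
      rw [List.length_cons]; ring
    omega

namespace PolyTime

variable {Γ : Type} {e f g : Γ → BTree} {α β σ : Γ → Type} [∀ c, Coded (α c)]
  [∀ c, Coded (β c)] [∀ c, Coded (σ c)]

/-- Bounded iteration: a left fold over a list is computed in polynomial time if its step is, and
if the sizes of all intermediate values are polynomially bounded. -/
theorem foldl_of_bound {l : ∀ c, List (β c)} {s : ∀ c, σ c} {step : ∀ c, σ c → β c → σ c}
    (hl : PolyTime e fun c => code (l c)) (hs : PolyTime e fun c => code (s c))
    (hstep : PolyTime (ext (ext e σ) fun p => β p.1) fun p => code (step p.1.1 p.1.2 p.2))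
    (hsize : ∃ q : Polynomial ℕ, ∀ c l', l' <+: l c →
      (code (l'.foldl (step c) (s c))).size ≤ q.eval (e c).size) :
    PolyTime e fun c => code ((l c).foldl (step c) (s c)) := by
  obtain ⟨L, pl, hL⟩ := hl
  obtain ⟨S₀, ps, hS₀⟩ := hs
  obtain ⟨S, p, hS⟩ := hstep
  obtain ⟨q, hq⟩ := hsize
  refine ⟨.seq (.pair .skip (.pair S₀ L)) (.seq (foldLoop S) (.seq .right .left)),
    ps + pl + pl * (p.comp (Polynomial.X + q + pl + 2) + 24) + q + 30, fun c => ?_⟩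
  obtain ⟨k, hk, hk'⟩ := hL c
  obtain ⟨j, hj, hj'⟩ := hS₀ c
  dsimp only at hk' hj'
  obtain ⟨i, hi, hi'⟩ := foldLoop_run (step := step c) (S := S) (x := e c)
    (T := p.eval ((e c).size + q.eval (e c).size + pl.eval (e c).size + 2)) (l c) (s c) (by
      rintro l₁ b l₂ hl
      obtain ⟨i, hi, hi'⟩ := hS ⟨⟨c, l₁.foldl (step c) (s c)⟩, b⟩
      refine ⟨i, le_trans ((Nat.le_add_right _ _).trans hi') (eval_mono p ?_), hi⟩
      have h₁ := hq c l₁ ⟨_, hl.symm⟩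
      have h₂ := size_code_lt_of_mem (a := b) (l := l c) (by simp [hl])
      simp only [ext, BTree.size_node]
      omega)
  refine ⟨_, ((RunsIn.skip _).pair (hj.pair hk)).seq (hi'.seq ((RunsIn.right _).seq (.left _))), ?_⟩
  have h₁ := hq c (l c) List.prefix_rfl
  have h₂ := length_lt_size_code (l c)
  dsimp only
  have h₃ : ((l c).length + 1) *
      (p.eval ((e c).size + q.eval (e c).size + pl.eval (e c).size + 2) + 24) ≤
      pl.eval (e c).size *
        (p.eval ((e c).size + q.eval (e c).size + pl.eval (e c).size + 2) + 24) :=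
    Nat.mul_le_mul_right _ (by omega)
  simp only [Polynomial.eval_add, Polynomial.eval_mul, Polynomial.eval_comp, Polynomial.eval_X,
    Polynomial.eval_ofNat]
  omega

/-- The condition on sizes holds in particular if each step increases the size by an amount that
does not depend on the current value. -/
theorem foldl {l : ∀ c, List (β c)} {s : ∀ c, σ c} {step : ∀ c, σ c → β c → σ c}
    (hl : PolyTime e fun c => code (l c)) (hs : PolyTime e fun c => code (s c))
    (hstep : PolyTime (ext (ext e σ) fun p => β p.1) fun p => code (step p.1.1 p.1.2 p.2))
    (hsize : ∃ q : Polynomial ℕ, ∀ c s b, b ∈ l c →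
      (code (step c s b)).size ≤ (code s).size + q.eval ((e c).size + (code b).size)) :
    PolyTime e fun c => code ((l c).foldl (step c) (s c)) := by
  refine foldl_of_bound hl hs hstep ?_
  obtain ⟨pl, hpl⟩ := hl.bound
  obtain ⟨ps, hps⟩ := hs.bound
  obtain ⟨q, hq⟩ := hsize
  refine ⟨ps + pl * q.comp (Polynomial.X + pl), fun c l' hl' => ?_⟩
  set N := q.eval ((e c).size + pl.eval (e c).size) with hN
  have key : ∀ l' : List (β c), (∀ b ∈ l', b ∈ l c) → ∀ s,
      (code (l'.foldl (step c) s)).size ≤ (code s).size + l'.length * N := by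
    intro l'
    induction l' with
    | nil => intro _ s; simp
    | cons b l' ih =>
      intro hb s
      have h₁ := ih (fun b hb' => hb b (List.mem_cons_of_mem _ hb')) (step c s b)
      have h₂ := hq c s b (hb b List.mem_cons_self)
      have h₃ : q.eval ((e c).size + (code b).size) ≤ N :=
        eval_mono q (Nat.add_le_add_left
          ((size_code_lt_of_mem (hb b List.mem_cons_self)).le.trans (hpl c)) _)
      rw [List.foldl_cons, List.length_cons, Nat.succ_mul]
      omega
  have h₁ := key l' (fun b hb => hl'.subset hb) (s c)
  have h₂ : l'.length * N ≤ pl.eval (e c).size * N := Nat.mul_le_mul_right _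
    (hl'.length_le.trans ((length_lt_size_code _).le.trans (hpl c)))
  have h₃ := hps c
  rw [hN] at h₁ h₂
  simp only [Polynomial.eval_add, Polynomial.eval_mul, Polynomial.eval_comp, Polynomial.eval_X]
  omega

end PolyTime

/-! ### Logic, lists, numbers and permutations -/

instance : Coded BTree := ⟨id, Function.injective_id⟩

instance {α β : Type} [Coded α] [Coded β] : Coded (α × β) where
  code p := .node (code p.1) (code p.2)
  code_injective p q h := by
    simp only [BTree.node.injEq] at h
    exact Prod.ext (code_injective h.1) (code_injective h.2)

theorem BTree.ofNat_injective : Function.Injective BTree.ofNat := by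
  intro a
  induction a with
  | zero => intro b h; cases b <;> simp_all [BTree.ofNat]
  | succ a ih =>
    intro b h
    cases b with
    | zero => simp [BTree.ofNat] at h
    | succ b => rw [ih (BTree.node.inj h).2]

instance : Coded ℕ := ⟨BTree.ofNat, BTree.ofNat_injective⟩

instance {k : ℕ} : Coded (Fin k) :=
  ⟨fun i => .ofNat i, fun _ _ h => Fin.ext (BTree.ofNat_injective h)⟩

theorem code_perm {k : ℕ} (σ : Perm (Fin k)) :
    Instance.encodePerm σ = code (List.ofFn fun i => σ i) := by
  rw [Instance.encodePerm]
  exact congrArg _ (List.map_ofFn (f := fun i => σ i) (g := code)).symm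

instance {k : ℕ} : Coded (Perm (Fin k)) where
  code := Instance.encodePerm
  code_injective σ τ h := by
    rw [code_perm, code_perm] at h
    exact Equiv.ext fun i => congrFun (List.ofFn_injective (code_injective h)) i

/-- The comparison of two trees with an explicit stack of pairs of subtrees that remain to be
compared; the state is `node stack .nil` until a difference is found. -/
def eqLoop : Prog :=
  .loop .left <| .ite (.seq .left (.seq .left .left))
    (.ite (.seq .left (.seq .left .right))
      (.pair (.pair
        (.pair (.seq .left (.seq .left (.seq .left .left)))
          (.seq .left (.seq .left (.seq .right .left))))
        (.pair
          (.pair (.seq .left (.seq .left (.seq .left .right)))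
            (.seq .left (.seq .left (.seq .right .right))))
          (.seq .left .right))) .nil)
      (.pair .nil (.pair .nil .nil)))
    (.ite (.seq .left (.seq .left .right))
      (.pair .nil (.pair .nil .nil))
      (.pair (.seq .left .right) .nil))

open Classical in
/-- If the comparison of the pairs on the stack `r` ends in `z`, then with `(x, y)` on top it ends in
`z` or in the state that reports a difference. -/
theorem eqLoop_run (x y r z : BTree) (k : ℕ) (h : RunsIn eqLoop (.node r .nil) k z) :
    ∃ j ≤ 60 * x.size + k, RunsIn eqLoop (.node (.node (.node x y) r) .nil) j
      (if x = y then z else .node .nil (.node .nil .nil)) := by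
  have left₂ (a b c d : BTree) : RunsIn (.seq .left (.seq .left .left))
      (.node (.node (.node a b) c) d) 5 a := (RunsIn.left _).seq ((RunsIn.left _).seq (.left _))
  have right₂ (a b c d : BTree) : RunsIn (.seq .left (.seq .left .right))
      (.node (.node (.node a b) c) d) 5 b := (RunsIn.left _).seq ((RunsIn.left _).seq (.right _))
  have fail (a : BTree) :
      RunsIn (.pair .nil (.pair .nil .nil)) a 5 (.node .nil (.node .nil .nil)) :=
    (RunsIn.nil _).pair ((RunsIn.nil _).pair (.nil _))
  have final : RunsIn eqLoop (.node .nil (.node .nil .nil)) 2 (.node .nil (.node .nil .nil)) :=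
    .loop_nil (.left _)
  induction x generalizing y r z k with
  | nil =>
    cases y with
    | nil =>
      have := RunsIn.loop_step (.left _) (.ite_nil (left₂ .nil .nil r .nil) (.ite_nil
        (right₂ _ _ _ _) (.pair ((RunsIn.left _).seq (.right _)) (.nil _)))) h
      rw [if_pos rfl]
      exact ⟨_, by simp only [BTree.size]; omega, this⟩
    | node a b =>
      have := RunsIn.loop_step (.left _) (.ite_nil (left₂ .nil (a.node b) r .nil) (.ite_node
        (right₂ _ _ _ _) (fail _))) final
      rw [if_neg (by simp)]
      exact ⟨_, by simp only [BTree.size]; omega, this⟩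
  | node x₁ x₂ ih₁ ih₂ =>
    cases y with
    | nil =>
      have := RunsIn.loop_step (.left _) (.ite_node (left₂ (x₁.node x₂) .nil r .nil) (.ite_nil
        (right₂ _ _ _ _) (fail _))) final
      rw [if_neg (by simp)]
      exact ⟨_, by simp only [BTree.size]; omega, this⟩
    | node y₁ y₂ =>
      obtain ⟨j₂, hj₂, h₂⟩ := ih₂ y₂ r z k h
      obtain ⟨j₁, hj₁, h₁⟩ := ih₁ y₁ (.node (.node x₂ y₂) r) _ j₂ h₂
      have := RunsIn.loop_step (.left _) (.ite_node (left₂ (x₁.node x₂) (y₁.node y₂) r .nil)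
        (.ite_node (right₂ _ _ _ _) (.pair (.pair
          (.pair ((RunsIn.left _).seq ((RunsIn.left _).seq ((RunsIn.left _).seq (.left _))))
            ((RunsIn.left _).seq ((RunsIn.left _).seq ((RunsIn.right _).seq (.left _)))))
          (.pair
            (.pair ((RunsIn.left _).seq ((RunsIn.left _).seq ((RunsIn.left _).seq (.right _))))
              ((RunsIn.left _).seq ((RunsIn.left _).seq ((RunsIn.right _).seq (.right _)))))
            ((RunsIn.left _).seq (.right _)))) (.nil _)))) h₁
      have hif : (if x₁.node x₂ = y₁.node y₂ then z else .node .nil (.node .nil .nil)) =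
          if x₁ = y₁ then if x₂ = y₂ then z else .node .nil (.node .nil .nil)
          else .node .nil (.node .nil .nil) := by
        by_cases e₁ : x₁ = y₁ <;> by_cases e₂ : x₂ = y₂ <;> simp [e₁, e₂]
      rw [hif]
      exact ⟨_, by simp only [BTree.size]; omega, this⟩

namespace PolyTime

variable {Γ : Type} {e f g : Γ → BTree}

theorem treeEq (hf : PolyTime e f) (hg : PolyTime e g) :
    PolyTime e fun c => code (f c = g c) := by
  refine PolyTime.comp (hf.node hg) ?_
  refine ⟨.seq (.pair (.pair .skip .nil) .nil) (.seq eqLoop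
    (.ite .right .nil (.pair .nil .nil))), 60 * Polynomial.X + 40, fun c => ?_⟩
  obtain ⟨k, hk, h⟩ := eqLoop_run (f c) (g c) .nil (.node .nil .nil) 2 (.loop_nil (.left _))
  have hs : (f c).size ≤ ((f c).node (g c)).size := by rw [BTree.size_node]; omega
  by_cases hc : f c = g c
  · rw [if_pos hc] at h
    have := (((RunsIn.skip ((f c).node (g c))).pair (.nil _)).pair (.nil _)).seq
      (h.seq (.ite_nil (q := .pair .nil .nil) (p := .nil) (.right _)
        ((RunsIn.nil _).pair (.nil _))))
    refine ⟨_, by simpa only [eq_true hc, code_true] using this, ?_⟩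
    · simp only [eq_true hc, code_true, BTree.size, Polynomial.eval_add, Polynomial.eval_mul,
        Polynomial.eval_X, Polynomial.eval_ofNat] at hs ⊢
      omega
  · rw [if_neg hc] at h
    have := (((RunsIn.skip ((f c).node (g c))).pair (.nil _)).pair (.nil _)).seq
      (h.seq (.ite_node (q := .pair .nil .nil) (p := .nil) (.right _) (.nil _)))
    refine ⟨_, by simpa only [eq_false hc, code_false] using this, ?_⟩
    · simp only [eq_false hc, code_false, BTree.size, Polynomial.eval_add, Polynomial.eval_mul,
        Polynomial.eval_X, Polynomial.eval_ofNat] at hs ⊢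
      omega

variable {α β : Γ → Type} [∀ c, Coded (α c)] [∀ c, Coded (β c)]

theorem eq {x y : ∀ c, α c} (hx : PolyTime e fun c => code (x c))
    (hy : PolyTime e fun c => code (y c)) : PolyTime e fun c => code (x c = y c) :=
  (treeEq hx hy).of_eq fun _ => congrArg code (propext code_injective.eq_iff)

section Logic

variable {P Q : Γ → Prop}

theorem true : PolyTime e fun _ => code True := const _

theorem false : PolyTime e fun _ => code False := const _

open Classical in
theorem and (hP : PolyTime e fun c => code (P c)) (hQ : PolyTime e fun c => code (Q c)) :
    PolyTime e fun c => code (P c ∧ Q c) :=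
  (ite hP hQ false).of_eq fun c => by by_cases h : P c <;> simp [h]

open Classical in
theorem not (hP : PolyTime e fun c => code (P c)) : PolyTime e fun c => code (¬ P c) :=
  (ite hP false true).of_eq fun c => by by_cases h : P c <;> simp [h]

open Classical in
theorem imp (hP : PolyTime e fun c => code (P c)) (hQ : PolyTime e fun c => code (Q c)) :
    PolyTime e fun c => code (P c → Q c) :=
  (ite hP hQ true).of_eq fun c => by by_cases h : P c <;> simp [h]

theorem iff (hP : PolyTime e fun c => code (P c)) (hQ : PolyTime e fun c => code (Q c)) :
    PolyTime e fun c => code (P c ↔ Q c) :=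
  (eq (α := fun _ => Prop) hP hQ).of_eq fun c => by rw [eq_iff_iff]

end Logic

section Lists

variable {l l' : ∀ c, List (α c)}

theorem fst {x : ∀ c, α c × β c} (h : PolyTime e fun c => code (x c)) :
    PolyTime e fun c => code (x c).1 := h.left

theorem snd {x : ∀ c, α c × β c} (h : PolyTime e fun c => code (x c)) :
    PolyTime e fun c => code (x c).2 := h.right

theorem prod {x : ∀ c, α c} {y : ∀ c, β c} (hx : PolyTime e fun c => code (x c))
    (hy : PolyTime e fun c => code (y c)) : PolyTime e fun c => code (x c, y c) := hx.node hy

theorem cons {a : ∀ c, α c} (ha : PolyTime e fun c => code (a c))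
    (hl : PolyTime e fun c => code (l c)) : PolyTime e fun c => code (a c :: l c) := ha.node hl

theorem tail (hl : PolyTime e fun c => code (l c)) : PolyTime e fun c => code (l c).tail :=
  hl.right.of_eq fun c => by cases l c <;> rfl

theorem ne_nil (hl : PolyTime e fun c => code (l c)) : PolyTime e fun c => code (l c ≠ []) :=
  not (eq hl nil)

theorem singleton {a : ∀ c, α c} (ha : PolyTime e fun c => code (a c)) :
    PolyTime e fun c => code [a c] := cons ha nil

theorem reverseAppend (hl : PolyTime e fun c => code (l c))
    (hl' : PolyTime e fun c => code (l' c)) :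
    PolyTime e fun c => code ((l c).reverse ++ l' c) := by
  refine (foldl (σ := fun c => List (α c)) (step := fun c s b => b :: s) hl hl'
    (cons v0 v1) ⟨Polynomial.X + 1, fun c s b _ => ?_⟩).of_eq fun c => ?_
  · rw [code_cons, BTree.size_node]
    simp only [Polynomial.eval_add, Polynomial.eval_X, Polynomial.eval_one]
    omega
  · simp

theorem append (hl : PolyTime e fun c => code (l c)) (hl' : PolyTime e fun c => code (l' c)) :
    PolyTime e fun c => code (l c ++ l' c) :=
  (reverseAppend (l := fun c => (l c).reverse ++ []) (reverseAppend (l' := fun _ => []) hl nil)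
    hl').of_eq fun c => by simp

theorem flatMap {f : ∀ c, α c → List (β c)} (hl : PolyTime e fun c => code (l c))
    (hf : PolyTime (ext e α) fun p => code (f p.1 p.2)) :
    PolyTime e fun c => code ((l c).flatMap (f c)) := by
  have hf' : PolyTime (ext (ext e fun c => List (β c)) fun p => α p.1)
      fun p => code (f p.1.1 p.2) :=
    PolyTime.comp (node (wk (wk (id e))) v0)
      (hf.restrict fun p : (Σ p : (Σ c, List (β c)), α p.1) => (⟨p.1.1, p.2⟩ : Σ c, α c))
  obtain ⟨q, hq⟩ := hf.bound
  refine (foldl (σ := fun c => List (β c)) (s := fun _ => [])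
    (step := fun c s b => s ++ f c b) hl nil
    (append v1 hf') ⟨q.comp (Polynomial.X + 1), fun c s b _ => ?_⟩).of_eq fun c => ?_
  · have h₁ := hq ⟨c, b⟩
    have h₂ := size_code_append s (f c b)
    simp only [ext, BTree.size_node, Polynomial.eval_comp, Polynomial.eval_add,
      Polynomial.eval_X, Polynomial.eval_one] at h₁ ⊢
    omega
  · have (l : List (α c)) (s : List (β c)) :
        l.foldl (fun s b => s ++ f c b) s = s ++ l.flatMap (f c) := by
      induction l generalizing s with
      | nil => simp
      | cons b l ih => simp [ih]
    exact congrArg code (this _ _)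

theorem map {f : ∀ c, α c → β c} (hl : PolyTime e fun c => code (l c))
    (hf : PolyTime (ext e α) fun p => code (f p.1 p.2)) :
    PolyTime e fun c => code ((l c).map (f c)) :=
  (flatMap (f := fun c a => [f c a]) hl (singleton hf)).of_eq fun c => by
    rw [List.map_eq_flatMap]

theorem filter {P : ∀ c, α c → Prop} {_ : ∀ c a, Decidable (P c a)}
    (hl : PolyTime e fun c => code (l c))
    (hP : PolyTime (ext e α) fun p => code (P p.1 p.2)) :
    PolyTime e fun c => code ((l c).filter fun a => P c a) := by
  refine (flatMap (f := fun c a => if P c a then [a] else []) hl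
    ((ite hP (singleton v0) nil).of_eq fun p => ?_)).of_eq fun c => ?_
  · by_cases h : P p.1 p.2 <;> simp [h, code_nil]
  · congr 1
    induction l c with
    | nil => rfl
    | cons a l ih => by_cases h : P c a <;> simp [h, ih]

theorem existsMem {P : ∀ c, α c → Prop} (hl : PolyTime e fun c => code (l c))
    (hP : PolyTime (ext e α) fun p => code (P p.1 p.2)) :
    PolyTime e fun c => code (∃ a ∈ l c, P c a) := by
  classical
  refine (ne_nil (l := fun c => (l c).filter fun a => P c a) (filter hl hP)).of_eq fun c => ?_
  congr 1
  simp [List.filter_eq_nil_iff]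

theorem forallMem {P : ∀ c, α c → Prop} (hl : PolyTime e fun c => code (l c))
    (hP : PolyTime (ext e α) fun p => code (P p.1 p.2)) :
    PolyTime e fun c => code (∀ a ∈ l c, P c a) := by
  refine (not (existsMem (P := fun c a => ¬ P c a) hl (not hP))).of_eq fun c => ?_
  congr 1
  simp

end Lists

section Numbers

instance : Coded Unit := ⟨fun _ => .nil, fun _ _ _ => rfl⟩

/-- A unary number is a list without information in its entries, so that loops over numbers are
loops over lists. -/
theorem _root_.HomExt.ofNat_eq_code (k : ℕ) : BTree.ofNat k = code (List.replicate k ()) := by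
  induction k with
  | zero => rfl
  | succ k ih => rw [List.replicate_succ, code_cons, ← ih]; rfl

variable {l : ∀ c, List (α c)} {k k' : Γ → ℕ}

theorem drop (hl : PolyTime e fun c => code (l c)) (hk : PolyTime e fun c => code (k c)) :
    PolyTime e fun c => code ((l c).drop (k c)) := by
  refine (foldl (σ := fun c => List (α c)) (β := fun _ => Unit)
    (l := fun c => List.replicate (k c) ()) (step := fun c s _ => s.tail)
    (hk.of_eq fun c => ofNat_eq_code _) hl (tail v1) ⟨0, fun c s b _ => ?_⟩).of_eq fun c => ?_
  · cases s with
    | nil => exact Nat.le_add_right _ _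
    | cons a s => rw [List.tail_cons, code_cons, BTree.size_node]; omega
  · have (k : ℕ) (s : List (α c)) :
        (List.replicate k ()).foldl (fun s _ => s.tail) s = s.drop k := by
      induction k generalizing s with
      | zero => rfl
      | succ k ih => rw [List.replicate_succ, List.foldl_cons, ih, List.drop_tail]
    exact congrArg code (this _ _)

theorem lt (hk : PolyTime e fun c => code (k c)) (hk' : PolyTime e fun c => code (k' c)) :
    PolyTime e fun c => code (k c < k' c) := by
  refine (ne_nil (drop (l := fun c => List.replicate (k' c) ())
    (hk'.of_eq fun c => ofNat_eq_code _) hk)).of_eq fun c => ?_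
  congr 1
  simp [Nat.sub_eq_zero_iff_le]

theorem ltFin {x : ∀ c, Fin (k c)} {y : ∀ c, Fin (k' c)} (hx : PolyTime e fun c => code (x c))
    (hy : PolyTime e fun c => code (y c)) : PolyTime e fun c => code ((x c : ℕ) < (y c : ℕ)) :=
  lt hx hy

theorem length (hl : PolyTime e fun c => code (l c)) : PolyTime e fun c => code (l c).length :=
  (map (f := fun _ _ => ()) hl nil).of_eq fun c => by
    rw [List.map_const']
    exact (ofNat_eq_code _).symm

theorem _root_.HomExt.size_code_nat (k : ℕ) : (code k).size = 2 * k + 1 := by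
  induction k with
  | zero => rfl
  | succ k ih =>
    have : (code (k + 1)).size = 1 + (code k).size + 1 := rfl
    omega

theorem _root_.HomExt.size_code_list_le {α : Type} [Coded α] {N : ℕ} (l : List α)
    (h : ∀ a ∈ l, (code a).size ≤ N) : (code l).size ≤ l.length * (N + 1) + 1 := by
  induction l with
  | nil => exact Nat.le_add_left _ _
  | cons a l ih =>
    rw [code_cons, BTree.size_node, List.length_cons, Nat.succ_mul]
    have := h a List.mem_cons_self
    have := ih fun b hb => h b (List.mem_cons_of_mem _ hb)
    omega

theorem range (hk : PolyTime e fun c => code (k c)) :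
    PolyTime e fun c => code (List.range (k c)) := by
  have key (k : ℕ) :
      (List.replicate k ()).foldl (fun s _ => s ++ [s.length]) [] = List.range k := by
    induction k with
    | zero => rfl
    | succ k ih => rw [List.replicate_succ', List.foldl_append, ih]; simp [List.range_succ]
  refine (foldl_of_bound (σ := fun _ => List ℕ) (β := fun _ => Unit)
    (l := fun c => List.replicate (k c) ()) (s := fun _ => [])
    (step := fun c s _ => s ++ [s.length])
    (hk.of_eq fun c => ofNat_eq_code _) nil (append v1 (singleton (length v1))) ?_).of_eq
    fun c => congrArg code (key _)
  obtain ⟨p, hp⟩ := hk.bound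
  refine ⟨p * (p + 1) + 1, fun c l' hl' => ?_⟩
  obtain ⟨h₁, h₂⟩ := List.prefix_replicate_iff.1 hl'
  have h₃ := hp c
  rw [size_code_nat] at h₃
  rw [h₂, key]
  refine (size_code_list_le (N := p.eval (e c).size) _ fun a ha => ?_).trans ?_
  · rw [size_code_nat]
    have := List.mem_range.1 ha
    omega
  · simp only [Polynomial.eval_add, Polynomial.eval_mul, Polynomial.eval_one, List.length_range]
    gcongr
    omega

theorem finRange (hk : PolyTime e fun c => code (k c)) :
    PolyTime e fun c => code (List.finRange (k c)) :=
  (range hk).of_eq fun c => by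
    rw [← List.map_coe_finRange_eq_range]
    exact congrArg BTree.ofList (List.map_map ..)

variable {σ τ : ∀ c, Perm (Fin (k c))}

theorem permApply {x : ∀ c, Fin (k c)} (hσ : PolyTime e fun c => code (σ c))
    (hx : PolyTime e fun c => code (x c)) : PolyTime e fun c => code (σ c (x c)) := by
  refine (left (drop (k := fun c => (x c : ℕ)) (l := fun c => List.ofFn fun i => σ c i)
    (hσ.of_eq fun c => code_perm _) hx)).of_eq fun c => ?_
  rw [List.drop_eq_getElem_cons (by simp), code_cons]
  simp [BTree.left]

theorem permMul (hσ : PolyTime e fun c => code (σ c)) (hτ : PolyTime e fun c => code (τ c)) :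
    PolyTime e fun c => code (σ c * τ c) := by
  refine (map (l := fun c => List.ofFn fun i => τ c i) (f := fun c i => σ c i)
    (hτ.of_eq fun c => code_perm _) (permApply hσ.wk v0)).of_eq fun c => ?_
  rw [List.map_ofFn]
  exact (code_perm (σ c * τ c)).symm

theorem permOne (hk : PolyTime e fun c => code (k c)) :
    PolyTime e fun c => code (1 : Perm (Fin (k c))) :=
  (finRange hk).of_eq fun c => by
    rw [← List.ofFn_id]
    exact (code_perm 1).symm

end Numbers

end PolyTime

/-! ### Enumerated types, function types and quantifiers -/

/-- A finite type with a list of its elements, each listed once. -/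
class Listed (α : Type) extends Coded α where
  elems : List α
  mem_elems : ∀ a, a ∈ elems
  nodup_elems : elems.Nodup

open Listed (elems mem_elems nodup_elems)

theorem length_filter_elems {α : Type} [Listed α] (P : α → Prop) [DecidablePred P] :
    ((elems : List α).filter P).length = Nat.card {a // P a} := by
  classical
  rw [← List.toFinset_card_of_nodup (nodup_elems.filter _), Nat.subtype_card]
  simp [mem_elems]

theorem length_elems (α : Type) [Listed α] : (elems : List α).length = Nat.card α := by
  have := length_filter_elems (fun _ : α => True)
  rw [Nat.card_congr (Equiv.subtypeUnivEquiv fun _ => trivial)] at this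
  simpa using this

theorem Listed.finite (α : Type) [Listed α] : Finite α :=
  Finite.of_surjective (fun i : Fin (elems : List α).length => elems[i]) fun a => by
    obtain ⟨i, hi, h⟩ := List.getElem_of_mem (mem_elems a)
    exact ⟨⟨i, hi⟩, h⟩

noncomputable instance : Listed Prop where
  elems := [True, False]
  mem_elems P := by by_cases h : P <;> simp [h]
  nodup_elems := by simp

instance {k : ℕ} : Listed (Fin k) := ⟨List.finRange k, List.mem_finRange, List.nodup_finRange k⟩

instance {α β : Type} [Listed α] [Listed β] : Listed (α × β) where
  elems := (elems : List α).flatMap fun a => (elems : List β).map fun b => (a, b)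
  mem_elems p := by simp [mem_elems]
  nodup_elems := nodup_elems.product nodup_elems

/-- A function on an enumerated type is written as its graph. -/
instance {α β : Type} [Listed α] [Coded β] : Coded (α → β) where
  code f := code ((elems : List α).map fun a => (a, f a))
  code_injective f g h := funext fun a => by
    have := List.map_inj_left.1 (code_injective h) a (mem_elems a)
    exact (Prod.mk.inj this).2

section Functions

variable {α β : Type} [Nonempty β]

open Classical in
/-- The functions that take values from the list `ys` on the entries of a list, and a fixed default
value elsewhere. -/
noncomputable def funsOn (ys : List β) : List α → List (α → β)
  | [] => [fun _ => Classical.arbitrary β]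
  | a :: l => (funsOn ys l).flatMap fun f => ys.map fun y => Function.update f a y

theorem mem_funsOn {ys : List β} (hys : ∀ y, y ∈ ys) (l : List α) (f : α → β)
    (hf : ∀ a ∉ l, f a = Classical.arbitrary β) : f ∈ funsOn ys l := by
  classical
  induction l generalizing f with
  | nil => exact List.mem_singleton.2 (funext fun a => hf a (by simp))
  | cons a l ih =>
    refine List.mem_flatMap.2 ⟨if a ∈ l then f else Function.update f a (Classical.arbitrary β),
      ih _ fun b hb => ?_, List.mem_map.2 ⟨f a, hys _, ?_⟩⟩
    · split_ifs with ha
      · exact hf b (by simp only [List.mem_cons, not_or]; exact ⟨fun h => hb (h ▸ ha), hb⟩)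
      · by_cases hba : b = a
        · simp [hba]
        · rw [Function.update_of_ne hba]
          exact hf b (by simp [hba, hb])
    · split_ifs <;> simp

theorem length_funsOn (ys : List β) (l : List α) :
    (funsOn ys l).length = ys.length ^ l.length := by
  induction l with
  | nil => rfl
  | cons a l ih => simp [funsOn, ih, List.length_flatMap, pow_succ]

end Functions

open Classical in
noncomputable instance {α β : Type} [Listed α] [Nonempty α] [Listed β] : Listed (α → β) where
  elems := if _ : Nonempty β then funsOn elems elems else []
  mem_elems f := by
    have hβ : Nonempty β := Nonempty.map f inferInstance
    rw [dif_pos hβ]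
    exact mem_funsOn mem_elems _ f fun a ha => absurd (mem_elems a) ha
  nodup_elems := by
    split_ifs with hβ
    · have : Finite α := Listed.finite α
      have : Finite β := Listed.finite β
      have : Fintype α := Fintype.ofFinite α
      have : Fintype β := Fintype.ofFinite β
      rw [← Multiset.coe_nodup, ← Multiset.toFinset_card_eq_card_iff_nodup, Multiset.coe_card,
        length_funsOn, length_elems, length_elems, Nat.card_eq_fintype_card,
        Nat.card_eq_fintype_card, ← Fintype.card_fun, ← Finset.card_univ]
      congr 1
      ext f
      simpa using mem_funsOn mem_elems _ f fun a ha => absurd (mem_elems a) ha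
    · exact List.nodup_nil

namespace PolyTime

variable {Γ : Type} {e f g : Γ → BTree} {α β : Γ → Type}

theorem elems_prop : PolyTime e fun _ => code (elems : List Prop) :=
  cons (α := fun _ => Prop) true (singleton false)

theorem elems_fin {k : Γ → ℕ} (hk : PolyTime e fun c => code (k c)) :
    PolyTime e fun c => code (elems : List (Fin (k c))) := finRange hk

theorem elems_prod [∀ c, Listed (α c)] [∀ c, Listed (β c)]
    (hα : PolyTime e fun c => code (elems : List (α c)))
    (hβ : PolyTime e fun c => code (elems : List (β c))) :
    PolyTime e fun c => code (elems : List (α c × β c)) :=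
  flatMap (f := fun c a => (elems : List (β c)).map fun b => (a, b)) hα
    (map (f := fun p b => (p.2, b)) (wk hβ) (prod v1 v0))

section Quantifiers

variable [∀ c, Listed (α c)] {P : ∀ c, α c → Prop}

theorem forallElem (hα : PolyTime e fun c => code (elems : List (α c)))
    (hP : PolyTime (ext e α) fun p => code (P p.1 p.2)) :
    PolyTime e fun c => code (∀ a, P c a) :=
  (forallMem hα hP).of_eq fun c => by simp [mem_elems]

theorem existsElem (hα : PolyTime e fun c => code (elems : List (α c)))
    (hP : PolyTime (ext e α) fun p => code (P p.1 p.2)) :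
    PolyTime e fun c => code (∃ a, P c a) :=
  (existsMem hα hP).of_eq fun c => by simp [mem_elems]

theorem card (hα : PolyTime e fun c => code (elems : List (α c)))
    (hP : PolyTime (ext e α) fun p => code (P p.1 p.2)) :
    PolyTime e fun c => code (Nat.card {a // P c a}) := by
  classical
  exact (length (l := fun c => (elems : List (α c)).filter fun a => P c a)
    (filter hα hP)).of_eq fun c => by rw [← length_filter_elems]

end Quantifiers

/-- Evaluation of a function that is given by its graph. -/
theorem apply [∀ c, Listed (α c)] [∀ c, Coded (β c)] {f : ∀ c, α c → β c} {a : ∀ c, α c}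
    (hf : PolyTime e fun c => code (f c)) (ha : PolyTime e fun c => code (a c)) :
    PolyTime e fun c => code (f c (a c)) := by
  classical
  refine (foldl (σ := fun _ => BTree) (β := fun c => α c × β c) (s := fun _ => .nil)
    (l := fun c => (elems : List (α c)).map fun a => (a, f c a))
    (step := fun c s p => if p.1 = a c then code p.2 else s) hf nil
    ((ite (P := fun p => p.2.1 = a p.1.1) (eq (fst v0) (wk (wk ha)))
      (snd v0) v1).of_eq fun p => ?_) ⟨Polynomial.X, fun c s b _ => ?_⟩).of_eq fun c => ?_
  · exact (apply_ite (code : BTree → BTree) _ _ _).symm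
  · have : (code b.2).size ≤ (code b).size := by
      have : (code b).size = (code b.1).size + (code b.2).size + 1 := rfl
      omega
    split_ifs
    · simp only [Polynomial.eval_X]
      exact this.trans ((Nat.le_add_left _ _).trans (Nat.le_add_left _ _))
    · exact Nat.le_add_right _ _
  · have key (l : List (α c)) (s : BTree) (h : a c ∈ l ∨ s = code (f c (a c))) :
        (l.map fun a => (a, f c a)).foldl (fun s p => if p.1 = a c then code p.2 else s) s =
          code (f c (a c)) := by
      induction l generalizing s with
      | nil => simpa using h
      | cons b l ih =>
        refine ih _ ?_
        by_cases hb : b = a c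
        · subst hb
          exact Or.inr (if_pos rfl)
        · rcases h with h | h
          · exact Or.inl ((List.mem_cons.1 h).resolve_left (Ne.symm hb))
          · exact Or.inr ((if_neg hb).trans h)
    exact key _ _ (Or.inl (mem_elems _))

/-- The number of functions from a list of length at most `b` to a list is polynomial in the length
of the latter, and they can be listed in polynomial time. -/
theorem funsOn_graphs [∀ c, Coded (α c)] [∀ c, Coded (β c)] [∀ c, Nonempty (β c)] (b : ℕ)
    {l : ∀ c, List (α c)} {ys : ∀ c, List (β c)} (hb : ∀ c, (l c).length ≤ b)
    (hn : ∀ c, (l c).Nodup) (hl : PolyTime e fun c => code (l c))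
    (hys : PolyTime e fun c => code (ys c)) :
    PolyTime e fun c => code ((funsOn (ys c) (l c)).map fun f => (l c).map fun a => (a, f a)) := by
  induction b generalizing Γ with
  | zero =>
    refine (const (code [([] : List Unit)])).of_eq fun c => ?_
    rw [List.eq_nil_of_length_eq_zero (Nat.le_zero.1 (hb c))]
    rfl
  | succ b ih =>
    refine cases (ne_nil hl) ?_ ?_
    · have hl' := hl.restrict (Subtype.val : {c // l c ≠ []} → Γ)
      have htail := ih (l := fun c : {c // l c ≠ []} => (l c).tail) (ys := fun c => ys c)
        (fun c => by have := hb c; rw [List.length_tail]; omega)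
        (fun c => (hn c).tail) (tail hl') (hys.restrict _)
      have hhead : PolyTime (fun c : {c // l c ≠ []} => e c)
          fun c => code ((l c).head c.2) := hl'.left.of_eq fun c => by
        obtain ⟨a, t, h⟩ := List.exists_cons_of_ne_nil c.2
        simp only [h]
        rfl
      refine (flatMap (α := fun c : {c // l c ≠ []} => List (α c × β c))
        (β := fun c => List (α c × β c))
        (f := fun c w => (ys c).map fun y => ((l c).head c.2, y) :: w) htail
        (map (Γ := Σ c : {c // l c ≠ []}, List (α c × β c)) (α := fun p => β p.1)
          (β := fun p => List (α p.1 × β p.1))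
          (f := fun p y => ((l p.1).head p.1.2, y) :: p.2) (wk (hys.restrict _))
          (cons (prod (wk (wk hhead)) v0) v1))).of_eq fun c => ?_
      obtain ⟨a, t, h⟩ := List.exists_cons_of_ne_nil c.2
      have hat : a ∉ t := (List.nodup_cons.1 (h ▸ hn c)).1
      simp only [h, List.head_cons, List.tail_cons, funsOn, List.flatMap_map, List.map_flatMap,
        List.map_map, List.map_cons]
      congr 2
      funext f
      congr 1
      funext y
      simp only [Function.comp, Function.update_self, List.cons.injEq, true_and]
      refine List.map_congr_left fun x hx => ?_
      classical
      exact congrArg _ (Function.update_of_ne (show x ≠ a from fun h => hat (h ▸ hx)) ..).symm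
    · refine (const (code [([] : List Unit)])).of_eq fun c => ?_
      rw [not_not.1 c.2]
      rfl

/-- If the domains have bounded size, quantifiers over functions can be evaluated in polynomial
time. -/
theorem elems_fun [∀ c, Listed (α c)] [∀ c, Nonempty (α c)] [∀ c, Listed (β c)]
    (hb : ∃ b, ∀ c, Nat.card (α c) ≤ b) (hα : PolyTime e fun c => code (elems : List (α c)))
    (hβ : PolyTime e fun c => code (elems : List (β c))) :
    PolyTime e fun c => code (elems : List (α c → β c)) := by
  obtain ⟨b, hb⟩ := hb
  refine cases (ne_nil hβ) ?_ ?_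
  · have hne (c : {c // (elems : List (β c)) ≠ []}) : Nonempty (β c) := by
      obtain ⟨a, -, -⟩ := List.exists_cons_of_ne_nil c.2
      exact ⟨a⟩
    refine (funsOn_graphs b
      (fun c : {c // (elems : List (β c)) ≠ []} => (length_elems _).trans_le (hb c.1))
      (fun _ => nodup_elems) (hα.restrict _) (hβ.restrict _)).of_eq fun c => ?_
    have : (elems : List (α c → β c)) = funsOn elems elems := dif_pos (hne c)
    rw [this]
    exact congrArg BTree.ofList (List.map_map ..)
  · refine nil.of_eq fun c => ?_
    have : ¬ Nonempty (β c) := fun ⟨b⟩ => by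
      have := mem_elems b
      rw [not_not.1 c.2] at this
      simp at this
    have : (elems : List (α c → β c)) = [] := dif_neg this
    rw [this]
    rfl

end PolyTime

/-! ### Finite sets with a group action -/

/-- Two finite `M`-sets are isomorphic if every subgroup is the stabilizer of equally many points
in both: a maximal isomorphism between invariant subsets is defined everywhere. -/
theorem exists_equiv_of_card_stabilizer_eq {M X Y : Type} [Group M] [MulAction M X]
    [MulAction M Y] [Finite X] [Finite Y]
    (h : ∀ S : Subgroup M, Nat.card {x : X // MulAction.stabilizer M x = S} =
      Nat.card {y : Y // MulAction.stabilizer M y = S}) :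
    ∃ e : X ≃ Y, ∀ (a : M) (x : X), e (a • x) = a • e x := by
  obtain ⟨R, hR, hmax⟩ := (Set.toFinite {R : Set (X × Y) |
    (∀ (a : M) x y, (x, y) ∈ R → (a • x, a • y) ∈ R) ∧
    (∀ x y y', (x, y) ∈ R → (x, y') ∈ R → y = y') ∧
    (∀ x x' y, (x, y) ∈ R → (x', y) ∈ R → x = x')}).exists_maximal ⟨∅, by simp⟩
  obtain ⟨hinv, hfun, hinj⟩ := hR
  have hstab {x : X} {y : Y} (hxy : (x, y) ∈ R) :
      MulAction.stabilizer M x = MulAction.stabilizer M y := by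
    ext a
    rw [MulAction.mem_stabilizer_iff, MulAction.mem_stabilizer_iff]
    have := hinv a x y hxy
    exact ⟨fun hx => hfun x _ _ (by rwa [hx] at this) hxy,
      fun hy => hinj _ _ y (by rwa [hy] at this) hxy⟩
  have htotal (x : X) : ∃ y, (x, y) ∈ R := by
    by_contra! hx
    -- otherwise `R` would match all points with the stabilizer of `x` except `x` itself
    obtain ⟨y, hy, hyR⟩ : ∃ y : Y, MulAction.stabilizer M y = MulAction.stabilizer M x ∧
        ∀ x', (x', y) ∉ R := by
      by_contra! hY
      choose F hF using hY
      let F' : {y : Y // MulAction.stabilizer M y = MulAction.stabilizer M x} →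
          {x' : X // MulAction.stabilizer M x' = MulAction.stabilizer M x} :=
        fun y => ⟨F y.1 y.2, (hstab (hF y.1 y.2)).trans y.2⟩
      have hF' : Function.Injective F' := fun y y' hyy' => Subtype.ext <|
        hfun _ _ _ (hF y.1 y.2) (by
          rw [show F y.1 y.2 = F y'.1 y'.2 from congrArg Subtype.val hyy']
          exact hF y'.1 y'.2)
      obtain ⟨y, hy⟩ := (hF'.bijective_of_nat_card_le (h _).le).2 ⟨x, rfl⟩
      have hy' : F y.1 y.2 = x := congrArg Subtype.val hy
      have := hF y.1 y.2
      rw [hy'] at this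
      exact hx y.1 this
    have hxR (a : M) (y' : Y) : (a • x, y') ∉ R := fun h' => by
      have := hinv a⁻¹ _ _ h'
      rw [inv_smul_smul] at this
      exact hx _ this
    have hyR' (a : M) (x' : X) : (x', a • y) ∉ R := fun h' => by
      have := hinv a⁻¹ _ _ h'
      rw [inv_smul_smul] at this
      exact hyR _ this
    have key (a b : M) : a • x = b • x ↔ a • y = b • y := by
      have : b⁻¹ * a ∈ MulAction.stabilizer M y ↔ b⁻¹ * a ∈ MulAction.stabilizer M x := by rw [hy]
      rw [MulAction.mem_stabilizer_iff, MulAction.mem_stabilizer_iff, mul_smul, mul_smul,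
        inv_smul_eq_iff, inv_smul_eq_iff] at this
      exact this.symm
    -- `R` can be extended to the orbits of `x` and `y`
    have := hmax (y := R ∪ Set.range fun a : M => (a • x, a • y)) ⟨?_, ?_, ?_⟩
      Set.subset_union_left (Or.inr ⟨1, rfl⟩)
    · exact hxR 1 _ this
    · rintro a x' y' (h' | ⟨b, h'⟩)
      · exact Or.inl (hinv a _ _ h')
      · obtain ⟨rfl, rfl⟩ := Prod.mk.inj h'
        exact Or.inr ⟨a * b, by simp only [mul_smul]⟩
    · rintro x' y' y'' (h' | ⟨b, h'⟩) (h'' | ⟨d, h''⟩)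
      · exact hfun _ _ _ h' h''
      · obtain ⟨rfl, rfl⟩ := Prod.mk.inj h''
        exact absurd h' (hxR _ _)
      · obtain ⟨rfl, rfl⟩ := Prod.mk.inj h'
        exact absurd h'' (hxR _ _)
      · obtain ⟨rfl, rfl⟩ := Prod.mk.inj h'
        obtain ⟨h₁, rfl⟩ := Prod.mk.inj h''
        exact ((key _ _).1 h₁).symm
    · rintro x' x'' y' (h' | ⟨b, h'⟩) (h'' | ⟨d, h''⟩)
      · exact hinj _ _ _ h' h''
      · obtain ⟨rfl, rfl⟩ := Prod.mk.inj h''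
        exact absurd h' (hyR' _ _)
      · obtain ⟨rfl, rfl⟩ := Prod.mk.inj h'
        exact absurd h'' (hyR' _ _)
      · obtain ⟨rfl, rfl⟩ := Prod.mk.inj h'
        obtain ⟨rfl, h₁⟩ := Prod.mk.inj h''
        exact ((key _ _).2 h₁).symm
  choose F hF using htotal
  have hFinj : Function.Injective F := fun x x' hx => hinj _ _ _ (hF x) (hx ▸ hF x')
  refine ⟨Equiv.ofBijective F ⟨hFinj, fun y => ?_⟩,
    fun a x => hfun _ _ _ (hF _) (hinv a _ _ (hF x))⟩
  let F' : {x : X // MulAction.stabilizer M x = MulAction.stabilizer M y} →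
      {y' : Y // MulAction.stabilizer M y' = MulAction.stabilizer M y} :=
    fun x => ⟨F x.1, (hstab (hF x.1)).symm.trans x.2⟩
  have hF' : Function.Injective F' := fun x x' hx =>
    Subtype.ext (hFinj (congrArg Subtype.val hx))
  obtain ⟨x, hx⟩ := (hF'.bijective_of_nat_card_le (h _).ge).2 ⟨y, rfl⟩
  exact ⟨x.1, congrArg Subtype.val hx⟩

/-! ### Partial solutions and their completion -/

section PartialSolutions

variable {G : Type} [Group G] {m : ℕ}

/-- `f` intertwines left multiplication by the arguments of the partial map with its values. -/
def Compat (γ : List (G × Perm (Fin m))) (f : G → Fin m) : Prop :=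
  ∀ p ∈ γ, ∀ h, f (p.1 * h) = p.2 (f h)

/-- `f` is of the form `g ↦ g • x` for an action of `G` on its image. -/
def IsOrbitMap (f : G → Fin m) : Prop := ∀ g h k, f g = f h → f (k * g) = f (k * h)

/-- The point `y` belongs to one of the orbits in the list. -/
def Cov (D : List (G → Fin m)) (y : Fin m) : Prop := ∃ f ∈ D, ∃ g, f g = y

/-- Membership in the subgroup generated by the domain of the partial map, by quantification over
sets. For finite `G` it suffices to multiply by generators, without inverses. -/
def Gen (γ : List (G × Perm (Fin m))) (a : G) : Prop :=
  ∀ C : G → Prop, C 1 → (∀ p ∈ γ, ∀ h, C h → C (p.1 * h)) → C a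

/-- The element `a` of the subgroup generated by the domain of the partial map fixes `x`. -/
def Fixes (γ : List (G × Perm (Fin m))) (a : G) (x : Fin m) : Prop :=
  ∃ f, Compat γ f ∧ f 1 = x ∧ f a = x

/-- The partial map extends to an action of the subgroup generated by its domain. -/
def Consistent (γ : List (G × Perm (Fin m))) : Prop := ∀ x, ∃ f, Compat γ f ∧ f 1 = x

/-- The points outside the orbits in `D` can be partitioned into orbits of `G`, as far as
numbers of points are concerned. The transitive `G`-sets are represented by the orbits of `G` on its
own subsets, with multiplicities `n`, and compared with the set of remaining points by the numbers
of points with a given stabilizer `S` in the subgroup generated by the domain of the partial map.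
This is a form of the subset-sum system in which constraints are indexed by subgroups instead of
conjugacy classes, and in which different orbits of subsets may stand for the same transitive
`G`-set. -/
def Balanced (γ : List (G × Perm (Fin m))) (D : List (G → Fin m)) : Prop :=
  ∃ n : (G → Prop) → Fin (m + 1), (∀ g C C', (∀ h, C' (g * h) ↔ C h) → n C' = n C) ∧
    ∀ S : G → Prop,
      Nat.card {p : (G → Prop) × Fin m // (p.2 : ℕ) < (n p.1 : ℕ) ∧
        ∀ a, (S a ↔ (Gen γ a ∧ ∀ h, p.1 (a * h) ↔ p.1 h))} =
      Nat.card {x : Fin m // ¬ Cov D x ∧ ∀ a, (S a ↔ (Gen γ a ∧ Fixes γ a x))}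

/-- The criterion for a partial solution to be part of a solution. -/
def Viable (γ : List (G × Perm (Fin m))) (D : List (G → Fin m)) : Prop :=
  Consistent γ ∧ Balanced γ D

/-- The entries of `D` parametrize disjoint orbits of an extension of the partial map. -/
structure Valid (γ : List (G × Perm (Fin m))) (D : List (G → Fin m)) : Prop where
  isOrbitMap : ∀ f ∈ D, IsOrbitMap f
  compat : ∀ f ∈ D, Compat γ f
  disjoint : D.Pairwise fun f f' => ∀ g h, f g ≠ f' h

/-- The extensions of the partial map for which the entries of `D` are orbit maps. -/
def Sols (γ : List (G × Perm (Fin m))) (D : List (G → Fin m)) : Set (G →* Perm (Fin m)) :=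
  {φ | (∀ p ∈ γ, φ p.1 = p.2) ∧ ∀ f ∈ D, ∀ g h, φ g (f h) = f (g * h)}

variable {γ : List (G × Perm (Fin m))} {D : List (G → Fin m)} {φ φ' : G →* Perm (Fin m)}

theorem gen_iff_mem_closure [Finite G] (a : G) :
    Gen γ a ↔ a ∈ Subgroup.closure {g | ∃ p ∈ γ, p.1 = g} := by
  constructor
  · intro h
    refine h (· ∈ Subgroup.closure {g | ∃ p ∈ γ, p.1 = g}) (one_mem _) fun p hp g hg => ?_
    exact mul_mem (Subgroup.subset_closure ⟨p, hp, rfl⟩) hg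
  · intro h C h₁ hC
    rw [← Subgroup.mem_toSubmonoid, Subgroup.closure_toSubmonoid_of_finite] at h
    induction h using Submonoid.closure_induction_left with
    | one => exact h₁
    | mul_left a ha b _ ih => obtain ⟨p, hp, rfl⟩ := ha; exact hC p hp b ih

/-- Orbit maps for the partial map that agree at one point agree along the orbit of the subgroup
generated by its domain. -/
theorem Gen.map_mul {a : G} (ha : Gen γ a) {f f' : G → Fin m} (hf : Compat γ f)
    (hf' : Compat γ f') {h h' : G} (hh : f h = f' h') : f (a * h) = f' (a * h') := by
  refine ha (fun a => f (a * h) = f' (a * h')) (by simpa) fun p hp g hg => ?_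
  rw [mul_assoc, mul_assoc, hf p hp, hf' p hp, hg]

theorem compat_orbit (hφ : φ ∈ Sols γ D) (x : Fin m) : Compat γ fun g => φ g x :=
  fun p hp h => by dsimp only; rw [map_mul, hφ.1 p hp]; rfl

theorem fixes_iff (hφ : φ ∈ Sols γ D) {a : G} (ha : Gen γ a) (x : Fin m) :
    Fixes γ a x ↔ φ a x = x := by
  constructor
  · rintro ⟨f, hf, h₁, h₂⟩
    have := ha.map_mul (compat_orbit hφ x) hf (h := 1) (h' := 1) (by simp [h₁])
    rw [mul_one] at this
    exact this.trans h₂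
  · exact fun h => ⟨_, compat_orbit hφ x, by simp, h⟩

theorem cov_apply (hφ : φ ∈ Sols γ D) (g : G) {x : Fin m} (hx : Cov D x) : Cov D (φ g x) := by
  obtain ⟨f, hf, h, rfl⟩ := hx
  exact ⟨f, hf, g * h, (hφ.2 f hf g h).symm⟩

theorem cov_apply_iff (hφ : φ ∈ Sols γ D) (g : G) {x : Fin m} : Cov D (φ g x) ↔ Cov D x :=
  ⟨fun h => by simpa using cov_apply hφ g⁻¹ h, cov_apply hφ g⟩

/-- A map of the `G`-set given by `φ` to the set of subsets of `G` that preserves stabilizers: after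
the choice of a base point in each orbit, a point is sent to the coset of the elements that move the
base point to it. -/
theorem exists_label (φ : G →* Perm (Fin m)) : ∃ label : Fin m → G → Prop,
    (∀ g x h, label (φ g x) (g * h) ↔ label x h) ∧
    ∀ g x, (∀ h, label x (g * h) ↔ label x h) ↔ φ g x = x := by
  let _ : MulAction G (Fin m) := MulAction.compHom _ φ
  let base (x : Fin m) : Fin m :=
    Quotient.out (Quotient.mk'' x : MulAction.orbitRel.Quotient G (Fin m))
  have hbase (g : G) (x : Fin m) : base (φ g x) = base x :=
    congrArg Quotient.out (MulAction.orbitRel.Quotient.quotient_smul_eq (g := g) (a := x))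
  have hbase' (x : Fin m) : ∃ g, φ g (base x) = x := by
    obtain ⟨g, hg⟩ := Quotient.exact (Quotient.out_eq
      (Quotient.mk'' x : MulAction.orbitRel.Quotient G (Fin m))).symm
    exact ⟨g, hg⟩
  refine ⟨fun x g => φ g (base x) = x, fun g x h => ?_, fun g x => ⟨fun h => ?_, fun h k => ?_⟩⟩
  · simp only [hbase, map_mul, Perm.mul_apply, EmbeddingLike.apply_eq_iff_eq]
  · obtain ⟨k, hk⟩ := hbase' x
    have : φ (g * k) (base x) = x := (h k).2 hk
    rwa [map_mul, Perm.mul_apply, hk] at this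
  · dsimp only
    rw [map_mul, Perm.mul_apply]
    conv_lhs => rw [← h, hbase]
    rw [EmbeddingLike.apply_eq_iff_eq]

/-- The multiplicity of a set `C` is the number of remaining points with label `C`. -/
theorem balanced_of_mem_sols (hφ : φ ∈ Sols γ D) : Balanced γ D := by
  obtain ⟨label, hl, hstab⟩ := exists_label φ
  have hle (C : G → Prop) : Nat.card {x // ¬ Cov D x ∧ label x = C} < m + 1 :=
    Nat.lt_succ_of_le ((Finite.card_subtype_le _).trans_eq (Nat.card_fin m))
  refine ⟨fun C => ⟨_, hle C⟩, fun g C C' hC => Fin.ext (Nat.card_congr ?_), fun S => ?_⟩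
  · refine ((φ g).subtypeEquiv fun x => ?_).symm
    rw [cov_apply_iff hφ]
    refine and_congr_right fun _ => ⟨?_, ?_⟩
    · rintro rfl
      funext h
      rw [← mul_inv_cancel_left g h, hl]
      exact propext (hC _).symm
    · rintro rfl
      funext h
      rw [← propext (hC h), hl]
  · have e (C : G → Prop) := Finite.equivFin {x // ¬ Cov D x ∧ label x = C}
    have hS (x : Fin m) : (∀ a, (S a ↔ (Gen γ a ∧ Fixes γ a x))) ↔
        ∀ a, (S a ↔ (Gen γ a ∧ ∀ h, label x (a * h) ↔ label x h)) := by
      refine forall_congr' fun a => iff_congr Iff.rfl (and_congr_right fun ha => ?_)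
      rw [fixes_iff hφ ha, hstab]
    have hval (C C' : G → Prop) (hC : C = C') (x : Fin m) (hx : ¬ Cov D x) (h : label x = C') :
        ((e C ⟨x, hx, h.trans hC.symm⟩ : Fin _) : ℕ) = (e C' ⟨x, hx, h⟩ : Fin _) := by
      subst hC
      rfl
    let F (x : {x // ¬ Cov D x ∧ ∀ a, (S a ↔ (Gen γ a ∧ Fixes γ a x))}) :
        {p : (G → Prop) × Fin m // (p.2 : ℕ) < Nat.card {x // ¬ Cov D x ∧ label x = p.1} ∧
          ∀ a, (S a ↔ (Gen γ a ∧ ∀ h, p.1 (a * h) ↔ p.1 h))} :=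
      ⟨(label x.1, Fin.castLE (Nat.le_of_lt_succ (hle _)) (e (label x.1) ⟨x.1, x.2.1, rfl⟩)),
        (e (label x.1) ⟨x.1, x.2.1, rfl⟩).2, (hS x.1).1 x.2.2⟩
    refine (Nat.card_eq_of_bijective F ⟨?_, ?_⟩).symm
    · intro x x' h
      have h' := Prod.mk.inj (congrArg Subtype.val h)
      have h₁ : label x.1 = label x'.1 := h'.1
      have h₂ : ((e (label x.1) ⟨x.1, x.2.1, rfl⟩ : Fin _) : ℕ) =
        (e (label x'.1) ⟨x'.1, x'.2.1, rfl⟩ : Fin _) := congrArg Fin.val h'.2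
      obtain ⟨x, hx⟩ := x
      obtain ⟨x', hx'⟩ := x'
      dsimp only at h₁ h₂
      have h₃ : ((e (label x) ⟨x, hx.1, rfl⟩ : Fin _) : ℕ) =
          (e (label x) ⟨x', hx'.1, h₁.symm⟩ : Fin _) :=
        h₂.trans (hval _ _ h₁ x' hx'.1 rfl).symm
      have := (e (label x)).injective (Fin.ext h₃)
      exact Subtype.ext (congrArg (fun y => y.1) this)
    · rintro ⟨⟨C, i⟩, hi, hC⟩
      obtain ⟨⟨x, hx, rfl⟩, h⟩ := (e C).surjective ⟨i, hi⟩
      refine ⟨⟨x, hx, (hS x).2 hC⟩, Subtype.ext (Prod.ext rfl (Fin.ext ?_))⟩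
      have h' := congrArg Fin.val h
      exact h'

theorem viable_of_mem_sols (hφ : φ ∈ Sols γ D) : Viable γ D :=
  ⟨fun x => ⟨_, compat_orbit hφ x, by simp⟩, balanced_of_mem_sols hφ⟩

end PartialSolutions

theorem cov_cons {G : Type} {m : ℕ} {D : List (G → Fin m)} {f : G → Fin m} {y : Fin m} :
    Cov (f :: D) y ↔ (∃ g, f g = y) ∨ Cov D y := by
  simp [Cov]

section PartialSolutions

variable {G : Type} [Group G] {m : ℕ} {γ : List (G × Perm (Fin m))} {D : List (G → Fin m)}
  {φ φ' : G →* Perm (Fin m)}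

/-- If the numbers of points agree, then the remaining points can be partitioned into orbits of
`G`. -/
theorem exists_mem_sols [Finite G] (hD : Valid γ D) (hV : Viable γ D) :
    ∃ φ, φ ∈ Sols γ D := by
  classical
  obtain ⟨hcons, n, hn, hcard⟩ := hV
  choose F hF hF₁ using hcons
  set M := Subgroup.closure {g | ∃ p ∈ γ, p.1 = g}
  have hM (a : M) : Gen γ (a : G) := (gen_iff_mem_closure _).2 a.2
  -- the action of `M` on the points
  let act (a : M) (x : Fin m) : Fin m := F x a
  have hact (a : M) {f : G → Fin m} (hf : Compat γ f) (h : G) : act a (f h) = f (a * h) := by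
    have := (hM a).map_mul (hF (f h)) hf (h := 1) (h' := h) (hF₁ _)
    rwa [mul_one] at this
  let instM : MulAction M (Fin m) :=
    { smul := act
      one_smul := hF₁
      mul_smul := fun a b x => (hact a (hF x) b).symm }
  have hgen (p) (hp : p ∈ γ) (x : Fin m) :
      (⟨p.1, Subgroup.subset_closure ⟨p, hp, rfl⟩⟩ : M) • x = p.2 x := by
    have := hF x p hp 1
    rwa [mul_one, hF₁] at this
  have hcov (a : M) {x : Fin m} (hx : Cov D x) : Cov D (a • x) := by
    obtain ⟨f, hf, h, rfl⟩ := hx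
    exact ⟨f, hf, a * h, (hact a (hD.compat f hf) h).symm⟩
  have hcov' (a : M) {x : Fin m} (hx : ¬ Cov D x) : ¬ Cov D (a • x) := fun h => by
    have := hcov a⁻¹ h
    rw [inv_smul_smul] at this
    exact hx this
  let instX : MulAction M {x // ¬ Cov D x} :=
    { smul := fun a x => ⟨a • x.1, hcov' a x.2⟩
      one_smul := fun x => Subtype.ext (one_smul M x.1)
      mul_smul := fun a b x => Subtype.ext (mul_smul a b x.1) }
  -- the `G`-set with the prescribed multiplicities
  have hn' (g : G) (C : G → Prop) : n (fun h => C (g⁻¹ * h)) = n C :=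
    hn g C _ fun h => by rw [inv_mul_cancel_left]
  let instY : MulAction G {p : (G → Prop) × Fin m // (p.2 : ℕ) < (n p.1 : ℕ)} :=
    { smul := fun g p => ⟨(fun h => p.1.1 (g⁻¹ * h), p.1.2), by rw [hn']; exact p.2⟩
      one_smul := fun p => Subtype.ext (Prod.ext (funext fun h => by
        change p.1.1 (1⁻¹ * h) = p.1.1 h
        rw [inv_one, one_mul]) rfl)
      mul_smul := fun a b p => Subtype.ext (Prod.ext (funext fun h => by
        change p.1.1 ((a * b)⁻¹ * h) = p.1.1 (b⁻¹ * (a⁻¹ * h))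
        rw [mul_inv_rev, mul_assoc]) rfl) }
  have hsmulY (g : G) (p : {p : (G → Prop) × Fin m // (p.2 : ℕ) < (n p.1 : ℕ)}) :
      g • p = p ↔ ∀ h, p.1.1 (g * h) ↔ p.1.1 h := by
    constructor
    · intro hp h
      have := congrFun (congrArg (fun q => q.1.1) hp) (g * h)
      change p.1.1 (g⁻¹ * (g * h)) = p.1.1 (g * h) at this
      rw [inv_mul_cancel_left] at this
      rw [this]
    · intro hp
      refine Subtype.ext (Prod.ext (funext fun h => ?_) rfl)
      change p.1.1 (g⁻¹ * h) = p.1.1 h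
      rw [← propext (hp (g⁻¹ * h)), mul_inv_cancel_left]
  have hS {Q : G → Prop} (S : Subgroup M) (T : Subgroup M)
      (hT : ∀ a : M, a ∈ T ↔ Q a) : T = S ↔
      ∀ a, ((∃ h : a ∈ M, (⟨a, h⟩ : M) ∈ S) ↔ (Gen γ a ∧ Q a)) := by
    constructor
    · rintro rfl a
      rw [gen_iff_mem_closure]
      exact ⟨fun ⟨h, ha⟩ => ⟨h, (hT _).1 ha⟩, fun ⟨h, ha⟩ => ⟨h, (hT ⟨a, h⟩).2 ha⟩⟩
    · intro h
      ext a
      rw [hT]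
      exact ⟨fun ha => ((h a).2 ⟨hM a, ha⟩).2, fun ha => ((h a).1 ⟨a.2, ha⟩).2⟩
  obtain ⟨e, he⟩ := exists_equiv_of_card_stabilizer_eq (M := M) (X := {x // ¬ Cov D x})
    (Y := {p : (G → Prop) × Fin m // (p.2 : ℕ) < (n p.1 : ℕ)}) fun S => by
      refine Eq.trans ?_ ((hcard fun a => ∃ h : a ∈ M, (⟨a, h⟩ : M) ∈ S).symm.trans ?_)
      · refine Nat.card_congr ((Equiv.subtypeEquivRight fun x => ?_).trans
          (Equiv.subtypeSubtypeEquivSubtypeInter _ fun x : Fin m =>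
            ∀ a, ((∃ h : a ∈ M, (⟨a, h⟩ : M) ∈ S) ↔ (Gen γ a ∧ Fixes γ a x))))
        refine hS (Q := fun a => Fixes γ a x) S _ fun a => ?_
        rw [MulAction.mem_stabilizer_iff, Subtype.ext_iff]
        constructor
        · exact fun h => ⟨F x, hF x, hF₁ x, h⟩
        · rintro ⟨f, hf, h₁, h₂⟩
          have := hact a hf 1
          rwa [h₁, mul_one, h₂] at this
      · refine Nat.card_congr ((Equiv.subtypeEquivRight fun p => ?_).trans
          (Equiv.subtypeSubtypeEquivSubtypeInter _ fun p : (G → Prop) × Fin m =>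
            ∀ a, ((∃ h : a ∈ M, (⟨a, h⟩ : M) ∈ S) ↔
              (Gen γ a ∧ ∀ h, p.1 (a * h) ↔ p.1 h)))).symm
        exact hS (Q := fun a => ∀ h, p.1.1 (a * h) ↔ p.1.1 h) S _ fun a => hsmulY a p
  -- the action of `G` on all points
  let A (g : G) (y : Fin m) : Fin m := if hy : Cov D y then hy.choose (g * hy.choose_spec.2.choose)
    else (e.symm (g • e ⟨y, hy⟩)).1
  have hA₁ (g : G) (f) (hf : f ∈ D) (h : G) : A g (f h) = f (g * h) := by
    have hy : Cov D (f h) := ⟨f, hf, h, rfl⟩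
    have h₁ := hy.choose_spec.1
    have h₂ := hy.choose_spec.2.choose_spec
    refine (dif_pos hy).trans ?_
    have : hy.choose = f := by
      by_contra hne
      have : Std.Symm fun f f' : G → Fin m => ∀ g h, f g ≠ f' h :=
        ⟨fun f f' h g g' hg => h g' g hg.symm⟩
      exact hD.disjoint.forall h₁ hf hne _ _ h₂
    exact (congrFun this _).trans
      (hD.isOrbitMap f hf _ _ _ ((congrFun this _).symm.trans h₂))
  have hA₂ (g : G) (x : {x // ¬ Cov D x}) : A g x = e.symm (g • e x) := dif_neg x.2
  let Φ : G →* Function.End (Fin m) :=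
    { toFun := A
      map_one' := funext fun y => by
        change A 1 y = y
        by_cases hy : Cov D y
        · obtain ⟨f, hf, h, rfl⟩ := hy
          rw [hA₁ 1 f hf, one_mul]
        · rw [hA₂ 1 ⟨y, hy⟩, one_smul, e.symm_apply_apply]
      map_mul' := fun a b => funext fun y => by
        change A (a * b) y = A a (A b y)
        by_cases hy : Cov D y
        · obtain ⟨f, hf, h, rfl⟩ := hy
          rw [hA₁ _ f hf, hA₁ _ f hf, hA₁ _ f hf, mul_assoc]
        · rw [hA₂ _ ⟨y, hy⟩, hA₂ _ ⟨y, hy⟩, hA₂, e.apply_symm_apply, mul_smul] }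
  refine ⟨Φ.toHomPerm, fun p hp => Equiv.ext fun y => ?_, fun f hf g h => hA₁ g f hf h⟩
  change A p.1 y = p.2 y
  by_cases hy : Cov D y
  · obtain ⟨f, hf, h, rfl⟩ := hy
    rw [hA₁ _ f hf, hD.compat f hf p hp]
  · have := he ⟨p.1, Subgroup.subset_closure ⟨p, hp, rfl⟩⟩ ⟨y, hy⟩
    rw [hA₂ _ ⟨y, hy⟩, ← hgen p hp]
    exact congrArg Subtype.val ((e.symm_apply_eq).2 this.symm)

/-! ### The search tree -/

/-- `f` parametrizes an orbit that contains the least remaining point, and the orbits in `D`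
together with it can be completed to a solution. -/
def IsChild (γ : List (G × Perm (Fin m))) (D : List (G → Fin m)) (f : G → Fin m) : Prop :=
  (¬ Cov D (f 1) ∧ ∀ y : Fin m, (y : ℕ) < (f 1 : ℕ) → Cov D y) ∧ IsOrbitMap f ∧ Compat γ f ∧
    (∀ g, ¬ Cov D (f g)) ∧ Viable γ (f :: D)

/-- The number of remaining points. -/
noncomputable def numRest (D : List (G → Fin m)) : ℕ := Nat.card {x // ¬ Cov D x}

theorem valid_nil : Valid γ [] := ⟨by simp, by simp, List.Pairwise.nil⟩

theorem IsChild.valid (hD : Valid γ D) {f : G → Fin m} (hf : IsChild γ D f) :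
    Valid γ (f :: D) where
  isOrbitMap := by simpa using ⟨hf.2.1, hD.isOrbitMap⟩
  compat := by simpa using ⟨hf.2.2.1, hD.compat⟩
  disjoint := List.pairwise_cons.2
    ⟨fun f' hf' g h hgh => hf.2.2.2.1 g ⟨f', hf', h, hgh.symm⟩, hD.disjoint⟩

theorem IsChild.numRest_lt {f : G → Fin m} (hf : IsChild γ D f) :
    numRest (f :: D) < numRest D := by
  classical
  rw [numRest, numRest, Nat.card_eq_fintype_card, Nat.card_eq_fintype_card]
  refine Fintype.card_lt_of_injective_of_notMem
    (fun x => ⟨x.1, fun h => x.2 (cov_cons.2 (Or.inr h))⟩)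
    (fun x y h => Subtype.ext (congrArg (fun x => x.1) h)) (b := ⟨f 1, hf.1.1⟩) ?_
  · rintro ⟨x, hx⟩
    exact x.2 (cov_cons.2 (Or.inl ⟨1, (congrArg Subtype.val hx).symm⟩))

theorem sols_cons_subset {f : G → Fin m} : Sols γ (f :: D) ⊆ Sols γ D :=
  fun _ h => ⟨h.1, fun f' hf' => h.2 f' (List.mem_cons_of_mem _ hf')⟩

/-- Each solution below a partial solution with a remaining point is a solution below one of its
children. -/
theorem exists_isChild (hφ : φ ∈ Sols γ D) (h : ∃ x, ¬ Cov D x) :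
    ∃ f, IsChild γ D f ∧ φ ∈ Sols γ (f :: D) := by
  classical
  obtain ⟨x, hx, hmin⟩ : ∃ x, ¬ Cov D x ∧ ∀ y < x, Cov D y := by
    obtain ⟨x, hx, hmin⟩ := WellFounded.has_min (wellFounded_lt (α := Fin m)) {x | ¬ Cov D x} h
    exact ⟨x, hx, fun y hy => not_not.1 fun h => hmin y h hy⟩
  have hφ' : φ ∈ Sols γ ((fun g => φ g x) :: D) :=
    ⟨hφ.1, List.forall_mem_cons.2 ⟨fun g h => by simp, hφ.2⟩⟩
  refine ⟨fun g => φ g x, ⟨⟨by simpa using hx, by simpa using hmin⟩, fun g h k hgh => ?_,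
    compat_orbit hφ x, fun g => by rwa [cov_apply_iff hφ], viable_of_mem_sols hφ'⟩, hφ'⟩
  simp only at hgh
  simp only [map_mul, Perm.mul_apply, hgh]

theorem IsChild.unique {f f' : G → Fin m} (hf : IsChild γ D f) (hf' : IsChild γ D f')
    (hφ : φ ∈ Sols γ (f :: D)) (hφ' : φ ∈ Sols γ (f' :: D)) : f = f' := by
  have h₁ : f 1 = f' 1 := by
    rcases lt_trichotomy (f 1) (f' 1) with h | h | h
    · exact absurd (hf'.1.2 _ h) hf.1.1
    · exact h
    · exact absurd (hf.1.2 _ h) hf'.1.1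
  funext g
  have h₂ := hφ.2 f List.mem_cons_self g 1
  have h₃ := hφ'.2 f' List.mem_cons_self g 1
  rw [mul_one] at h₂ h₃
  rw [← h₂, ← h₃, h₁]

theorem sols_subsingleton (h : ∀ x, Cov D x) (hφ : φ ∈ Sols γ D) (hφ' : φ' ∈ Sols γ D) :
    φ = φ' := by
  refine MonoidHom.ext fun g => Equiv.ext fun x => ?_
  obtain ⟨f, hf, k, rfl⟩ := h x
  rw [hφ.2 f hf, hφ'.2 f hf]

theorem length_add_numRest_le (hD : Valid γ D) : D.length + numRest D ≤ m := by
  classical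
  have hinj : Function.Injective
      (Sum.elim (fun i : Fin D.length => D[i] 1) (fun x : {x // ¬ Cov D x} => x.1)) := by
    rintro (i | x) (j | y) h <;> simp only [Sum.elim_inl, Sum.elim_inr] at h
    · rw [Sum.inl.injEq]
      by_contra hij
      have := List.pairwise_iff_get.1 hD.disjoint
      rcases lt_or_gt_of_ne hij with hij | hij
      · exact this _ _ hij 1 1 h
      · exact this _ _ hij 1 1 h.symm
    · exact absurd ⟨_, List.getElem_mem i.2, 1, h⟩ y.2
    · exact absurd ⟨_, List.getElem_mem j.2, 1, h.symm⟩ x.2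
    · rw [Subtype.ext h]
  have := Nat.card_le_card_of_injective _ hinj
  rwa [Nat.card_sum, Nat.card_fin, Nat.card_fin] at this

end PartialSolutions

/-! ### Listing the elements of a group given by generators -/

section Words

variable {G : Type} [Group G]

/-- The products of at most `k` entries of a list. -/
def words (l : List G) : ℕ → List G
  | 0 => [1]
  | k + 1 => words l k ++ (words l k).flatMap fun w => l.map fun g => g * w

/-- Until all elements are reached, at least one element is added in each round. -/
theorem mem_words {l : List G} {k : ℕ} [Finite G] (hl : Subgroup.closure {g | g ∈ l} = ⊤)
    (hk : Nat.card G ≤ k) (a : G) : a ∈ words l k := by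
  classical
  have key (k : ℕ) : (∀ a, a ∈ words l k) ∨ k < (words l k).toFinset.card := by
    induction k with
    | zero => exact Or.inr (by simp [words])
    | succ k ih =>
      have hsub : (words l k).toFinset ⊆ (words l (k + 1)).toFinset := fun a ha => by
        simp only [words, List.toFinset_append, Finset.mem_union]
        exact Or.inl ha
      rcases ih with h | h
      · exact Or.inl fun a => List.mem_append_left _ (h a)
      rcases hsub.eq_or_ssubset with heq | hlt
      · refine Or.inl fun a => List.mem_append_left _ ?_
        have ha : a ∈ Subgroup.closure {g | g ∈ l} := hl ▸ Subgroup.mem_top a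
        rw [← Subgroup.mem_toSubmonoid, Subgroup.closure_toSubmonoid_of_finite] at ha
        have hone (k : ℕ) : 1 ∈ words l k := by
          induction k with
          | zero => simp [words]
          | succ k ih => exact List.mem_append_left _ ih
        induction ha using Submonoid.closure_induction_left with
        | one => exact hone k
        | mul_left g hg b _ ih =>
          rw [← List.mem_toFinset, heq, List.mem_toFinset]
          exact List.mem_append_right _
            (List.mem_flatMap.2 ⟨b, ih, List.mem_map.2 ⟨g, hg, rfl⟩⟩)
      · exact Or.inr (lt_of_le_of_lt (Nat.succ_le_of_lt h) (Finset.card_lt_card hlt))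
  rcases key k with h | h
  · exact h a
  · have : Fintype G := Fintype.ofFinite G
    have h' := Finset.card_le_univ (words l k).toFinset
    rw [Nat.card_eq_fintype_card] at hk
    omega

end Words

open Classical in
/-- The entries of a list without repetitions. -/
noncomputable def distinct {α : Type} (l : List α) : List α :=
  l.foldl (fun s a => if a ∈ s then s else a :: s) []

theorem mem_distinct_and_nodup {α : Type} (l : List α) :
    (∀ a, a ∈ distinct l ↔ a ∈ l) ∧ (distinct l).Nodup := by
  classical
  have key (l s : List α) (hs : s.Nodup) :
      (∀ a, a ∈ l.foldl (fun s a => if a ∈ s then s else a :: s) s ↔ a ∈ s ∨ a ∈ l) ∧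
      (l.foldl (fun s a => if a ∈ s then s else a :: s) s).Nodup := by
    induction l generalizing s with
    | nil => simpa using hs
    | cons b l ih =>
      rw [List.foldl_cons]
      split_ifs with hb
      · refine ⟨fun a => ?_, (ih s hs).2⟩
        rw [(ih s hs).1, List.mem_cons]
        exact ⟨fun h => h.imp_right Or.inr, fun h => by
          rcases h with h | rfl | h
          exacts [Or.inl h, Or.inl hb, Or.inr h]⟩
      · have hs' : (b :: s).Nodup := List.nodup_cons.2 ⟨hb, hs⟩
        refine ⟨fun a => ?_, (ih _ hs').2⟩
        rw [(ih _ hs').1, List.mem_cons, List.mem_cons]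
        tauto
  refine ⟨fun a => ?_, (key l [] List.nodup_nil).2⟩
  exact ((key l [] List.nodup_nil).1 a).trans (by simp)

theorem PolyTime.distinct {Γ : Type} {e : Γ → BTree} {α : Γ → Type} [∀ c, Coded (α c)]
    {l : ∀ c, List (α c)} (hl : PolyTime e fun c => code (l c)) :
    PolyTime e fun c => code (distinct (l c)) := by
  classical
  refine foldl (σ := fun c => List (α c)) (s := fun _ => [])
    (step := fun c s a => if a ∈ s then s else a :: s) hl nil
    ((ite (P := fun p : Σ p : (Σ c, List (α c)), α p.1 => ∃ a ∈ p.1.2, a = p.2)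
      (existsMem (l := fun p : Σ p : (Σ c, List (α c)), α p.1 => p.1.2)
        (P := fun p a => a = p.2) v1 (eq v0 v1)) v1 (cons v0 v1)).of_eq fun p => ?_)
    ⟨Polynomial.X + 1, fun c s b _ => ?_⟩
  · simp only [exists_eq_right]
    exact (apply_ite code _ _ _).symm
  · split_ifs
    · exact Nat.le_add_right _ _
    · rw [code_cons, BTree.size_node]
      simp only [Polynomial.eval_add, Polynomial.eval_X, Polynomial.eval_one]
      omega

/-! ### Instances with a bounded domain group -/

/-- Instances with domain group of order at most `B`. They form the context in which the definitions
of the search are translated into programs. -/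
abbrev BInst (B : ℕ) : Type := {I : Instance // Nat.card I.G ≤ B}

variable {B : ℕ}

/-- The domain group. -/
def Dom (c : BInst B) : Type := c.1.G

noncomputable instance (c : BInst B) : Group (Dom c) := inferInstanceAs (Group c.1.G)
instance (c : BInst B) : Finite (Dom c) := inferInstanceAs (Finite c.1.G)
instance (c : BInst B) : Coded (Dom c) :=
  ⟨fun g => code g.1, fun _ _ h => Subtype.ext (code_injective h)⟩

namespace BInst

/-- The given generators as elements of the domain group. -/
def gens (c : BInst B) : List (Dom c) :=
  c.1.gens.attach.map fun g => ⟨g.1, Subgroup.subset_closure g.2⟩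

/-- The given partial map. -/
def graph (c : BInst B) : List (Dom c × Perm (Fin c.1.m)) :=
  c.1.graph.attach.map fun p => (⟨p.1.1, c.1.dom_mem p.1 p.2⟩, p.1.2)

theorem closure_gens (c : BInst B) : Subgroup.closure {g | g ∈ c.gens} = ⊤ := by
  have : {g | g ∈ c.gens} = ((↑) : c.1.G → Perm (Fin c.1.n)) ⁻¹' {g | g ∈ c.1.gens} := by
    ext g
    refine List.mem_map.trans ⟨?_, fun h => ⟨⟨g.1, h⟩, List.mem_attach _ _, rfl⟩⟩
    rintro ⟨a, -, rfl⟩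
    exact a.2
  rw [this]
  exact Subgroup.closure_closure_coe_preimage

theorem mem_solutions (c : BInst B) (φ : Dom c →* Perm (Fin c.1.m)) :
    φ ∈ Sols c.graph [] ↔ (show c.1.G →* Perm (Fin c.1.m) from φ) ∈ c.1.solutions := by
  simp only [Sols, graph, List.mem_map, List.mem_attach, true_and, Set.mem_ofPred_eq,
    List.not_mem_nil, false_imp_iff, implies_true, and_true, Instance.solutions]
  constructor
  · exact fun h p hp => h _ ⟨⟨p, hp⟩, rfl⟩
  · rintro h _ ⟨p, rfl⟩
    exact h p.1 p.2

end BInst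

noncomputable instance (c : BInst B) : Listed (Dom c) where
  elems := distinct (words c.gens B)
  mem_elems a := ((mem_distinct_and_nodup _).1 a).2 (mem_words c.closure_gens c.2 a)
  nodup_elems := (mem_distinct_and_nodup _).2

namespace PolyTime

variable {Γ : Type} {e : Γ → BTree} {r : Γ → BInst B}

theorem degree (hE : PolyTime e fun c => (r c).1.encode) : PolyTime e fun c => code (r c).1.n :=
  hE.left

theorem codegree (hE : PolyTime e fun c => (r c).1.encode) : PolyTime e fun c => code (r c).1.m :=
  hE.right.left

theorem gens (hE : PolyTime e fun c => (r c).1.encode) : PolyTime e fun c => code (r c).gens :=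
  hE.right.right.left.of_eq fun c => congrArg BTree.ofList
    ((List.map_map (g := (code : Dom (r c) → BTree))).trans
      (List.attach_map_val (l := (r c).1.gens) (f := Instance.encodePerm))).symm

theorem graph (hE : PolyTime e fun c => (r c).1.encode) : PolyTime e fun c => code (r c).graph :=
  hE.right.right.right.left.of_eq fun _ => congrArg BTree.ofList
    ((List.map_map ..).trans (List.attach_map_val (f := fun p : _ × _ =>
      BTree.node (Instance.encodePerm p.1) (Instance.encodePerm p.2)))).symm

theorem one (hE : PolyTime e fun c => (r c).1.encode) : PolyTime e fun c => code (1 : Dom (r c)) :=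
  permOne (degree hE)

theorem mul {a b : ∀ c, Dom (r c)} (ha : PolyTime e fun c => code (a c))
    (hb : PolyTime e fun c => code (b c)) : PolyTime e fun c => code (a c * b c) :=
  permMul (k := fun c => (r c).1.n) (σ := fun c => (a c).1) (τ := fun c => (b c).1) ha hb

theorem elems_dom (hE : PolyTime e fun c => (r c).1.encode) :
    PolyTime e fun c => code (elems : List (Dom (r c))) := by
  refine distinct ?_
  -- the length `B` of the words does not depend on the instance, so that a program for each length
  -- is enough
  have (k : ℕ) : PolyTime e fun c => code (words (r c).gens k) := by
    induction k with
    | zero => exact singleton (one hE)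
    | succ k ih =>
      exact append ih (flatMap (f := fun c w => (r c).gens.map fun g => g * w) ih
        (map (f := fun p g => g * p.2) (wk (gens hE))
          (mul (r := fun p : Σ p : (Σ c, Dom (r c)), Dom (r p.1) => r p.1.1) v0 v1)))
  exact this B

theorem elems_sets (hE : PolyTime e fun c => (r c).1.encode) :
    PolyTime e fun c => code (elems : List (Dom (r c) → Prop)) :=
  elems_fun ⟨B, fun c => (r c).2⟩ (elems_dom hE) elems_prop

theorem elems_maps (hE : PolyTime e fun c => (r c).1.encode) :
    PolyTime e fun c => code (elems : List (Dom (r c) → Fin (r c).1.m)) :=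
  elems_fun ⟨B, fun c => (r c).2⟩ (elems_dom hE) (elems_fin (codegree hE))

/-- The number of tuples of multiplicities is at most `(m + 1) ^ 2 ^ B`, a polynomial in `m`. -/
theorem elems_multiplicities (hE : PolyTime e fun c => (r c).1.encode) :
    PolyTime e fun c => code (elems : List ((Dom (r c) → Prop) → Fin ((r c).1.m + 1))) :=
  elems_fun ⟨2 ^ B, fun c => by
    rw [Nat.card_fun, Nat.card_eq_fintype_card, Fintype.card_prop]
    exact Nat.pow_le_pow_right Nat.two_pos (r c).2⟩
    (elems_sets hE) (elems_fin (nil.node (codegree hE)))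

section Formulas

/-! The programs below follow the definitions of the formulas word by word. -/

variable {f : ∀ c, Dom (r c) → Fin (r c).1.m} {D : ∀ c, List (Dom (r c) → Fin (r c).1.m)}
  {a : ∀ c, Dom (r c)} {x : ∀ c, Fin (r c).1.m}

theorem compat (hE : PolyTime e fun c => (r c).1.encode) (hf : PolyTime e fun c => code (f c)) :
    PolyTime e fun c => code (Compat (r c).graph (f c)) :=
  forallMem (graph hE) (forallElem (elems_dom (wk hE))
    (eq (apply (wk (wk hf)) (mul (fst v1) v0)) (permApply (snd v1) (apply (wk (wk hf)) v0))))

theorem isOrbitMap (hE : PolyTime e fun c => (r c).1.encode)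
    (hf : PolyTime e fun c => code (f c)) : PolyTime e fun c => code (IsOrbitMap (f c)) :=
  forallElem (elems_dom hE) (forallElem (elems_dom (wk hE)) (forallElem (elems_dom (wk (wk hE)))
    (imp (eq (apply (wk (wk (wk hf))) v2) (apply (wk (wk (wk hf))) v1))
      (eq (apply (wk (wk (wk hf))) (mul v0 v2)) (apply (wk (wk (wk hf))) (mul v0 v1))))))

theorem cov (hE : PolyTime e fun c => (r c).1.encode) (hD : PolyTime e fun c => code (D c))
    (hx : PolyTime e fun c => code (x c)) : PolyTime e fun c => code (Cov (D c) (x c)) :=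
  existsMem hD (existsElem (elems_dom (wk hE)) (eq (apply v1 v0) (wk (wk hx))))

theorem gen (hE : PolyTime e fun c => (r c).1.encode) (ha : PolyTime e fun c => code (a c)) :
    PolyTime e fun c => code (Gen (r c).graph (a c)) :=
  forallElem (elems_sets hE) (imp (apply v0 (one (wk hE))) (imp
    (forallMem (graph (wk hE)) (forallElem (elems_dom (wk (wk hE)))
      (imp (apply v2 v0) (apply v2 (mul (fst v1) v0))))) (apply v0 (wk ha))))

theorem fixes (hE : PolyTime e fun c => (r c).1.encode) (ha : PolyTime e fun c => code (a c))
    (hx : PolyTime e fun c => code (x c)) :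
    PolyTime e fun c => code (Fixes (r c).graph (a c) (x c)) :=
  existsElem (elems_maps hE) (and (compat (wk hE) v0)
    (and (eq (apply v0 (one (wk hE))) (wk hx)) (eq (apply v0 (wk ha)) (wk hx))))

theorem consistent (hE : PolyTime e fun c => (r c).1.encode) :
    PolyTime e fun c => code (Consistent (r c).graph) :=
  forallElem (elems_fin (codegree hE)) (existsElem (elems_maps (wk hE))
    (and (compat (wk (wk hE)) v0) (eq (apply v0 (one (wk (wk hE)))) v1)))

theorem balanced (hE : PolyTime e fun c => (r c).1.encode) (hD : PolyTime e fun c => code (D c)) :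
    PolyTime e fun c => code (Balanced (r c).graph (D c)) :=
  existsElem (elems_multiplicities hE) (and
    (forallElem (elems_dom (wk hE)) (forallElem (elems_sets (wk (wk hE)))
      (forallElem (elems_sets (wk (wk (wk hE)))) (imp
        (forallElem (elems_dom (wk (wk (wk (wk hE))))) (iff (apply v1 (mul v3 v0)) (apply v2 v0)))
        (eq (apply v3 v0) (apply v3 v1))))))
    (forallElem (elems_sets (wk hE)) (eq (α := fun _ => ℕ)
      (card (elems_prod (elems_sets (wk (wk hE))) (elems_fin (codegree (wk (wk hE)))))
        (and (ltFin (snd v0) (apply v2 (fst v0)))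
          (forallElem (elems_dom (wk (wk (wk hE)))) (iff (apply v2 v0)
            (and (gen (wk (wk (wk (wk hE)))) v0)
              (forallElem (elems_dom (wk (wk (wk (wk hE)))))
                (iff (apply (fst v2) (mul v1 v0)) (apply (fst v2) v0))))))))
      (card (elems_fin (codegree (wk (wk hE))))
        (and (not (cov (wk (wk (wk hE))) (wk (wk (wk hD))) v0))
          (forallElem (elems_dom (wk (wk (wk hE)))) (iff (apply v2 v0)
            (and (gen (wk (wk (wk (wk hE)))) v0) (fixes (wk (wk (wk (wk hE)))) v0 v1)))))))))

theorem viable (hE : PolyTime e fun c => (r c).1.encode) (hD : PolyTime e fun c => code (D c)) :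
    PolyTime e fun c => code (Viable (r c).graph (D c)) :=
  and (consistent hE) (balanced hE hD)

theorem isChild (hE : PolyTime e fun c => (r c).1.encode) (hD : PolyTime e fun c => code (D c))
    (hf : PolyTime e fun c => code (f c)) :
    PolyTime e fun c => code (IsChild (r c).graph (D c) (f c)) :=
  and (and (not (cov hE hD (apply hf (one hE)))) (forallElem (elems_fin (codegree hE))
    (imp (ltFin v0 (wk (apply hf (one hE)))) (cov (wk hE) (wk hD) v0))))
    (and (isOrbitMap hE hf) (and (compat hE hf) (and
      (forallElem (elems_dom hE) (not (cov (wk hE) (wk hD) (apply (wk hf) v0))))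
      (viable hE (cons hf hD)))))

end Formulas

end PolyTime

/-! ### Partial solutions as data -/

/-- The type of partial solutions: lists of maps from the domain group to the points. -/
abbrev State (c : BInst B) : Type := List (Dom c → Fin c.1.m)

/-- No point remains. -/
def Done {c : BInst B} (D : State c) : Prop := ∀ x, Cov D x

open Classical in
/-- The partial solutions with one more orbit, which contains the least remaining point. -/
noncomputable def childStates (c : BInst B) (D : State c) : List (State c) :=
  ((elems : List (Dom c → Fin c.1.m)).filter fun f => IsChild c.graph D f).map fun f => f :: D

open Classical in
/-- The values on the generators of the homomorphism given by a complete list of orbits. The image of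
`i` under `g` is found by a search for a point `f h = i`, whose image is `f (g * h)`. -/
noncomputable def values (c : BInst B) (D : State c) : List (List (Fin c.1.m)) :=
  c.gens.map fun g => (elems : List (Fin c.1.m)).flatMap fun i =>
    (elems : List (Fin c.1.m)).filter fun y => ∃ f ∈ D, ∃ h, f h = i ∧ f (g * h) = y

theorem mem_childStates {c : BInst B} {D D' : State c} :
    D' ∈ childStates c D ↔ ∃ f, IsChild c.graph D f ∧ D' = f :: D := by
  simp only [childStates, List.mem_map, List.mem_filter, mem_elems, true_and, decide_eq_true_eq]
  exact exists_congr fun f => and_congr_right fun _ => eq_comm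

theorem nodup_childStates (c : BInst B) (D : State c) : (childStates c D).Nodup :=
  (nodup_elems.filter _).map fun _ _ h => (List.cons.inj h).1

theorem not_done {c : BInst B} {D : State c} (h : ¬ Done D) : ∃ x, ¬ Cov D x := not_forall.1 h

theorem childStates_ne_nil {c : BInst B} {D : State c} (hD : Valid c.graph D)
    (hV : Viable c.graph D) (h : ¬ Done D) : childStates c D ≠ [] := by
  obtain ⟨φ, hφ⟩ := exists_mem_sols hD hV
  obtain ⟨f, hf, -⟩ := exists_isChild hφ (not_done h)
  exact List.ne_nil_of_mem (mem_childStates.2 ⟨f, hf, rfl⟩)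

/-- A homomorphism on the domain group as a homomorphism on the group of the instance. -/
def toHom {c : BInst B} (φ : Dom c →* Perm (Fin c.1.m)) : c.1.G →* Perm (Fin c.1.m) := φ

theorem code_values {c : BInst B} {D : State c} (h : Done D) {φ : Dom c →* Perm (Fin c.1.m)}
    (hφ : φ ∈ Sols c.graph D) : code (values c D) = c.1.encodeHom (toHom φ) := by
  classical
  have key (g : Dom c) : ((elems : List (Fin c.1.m)).flatMap fun i =>
      (elems : List (Fin c.1.m)).filter fun y => ∃ f ∈ D, ∃ h, f h = i ∧ f (g * h) = y) =
      List.ofFn (φ g) := by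
    rw [List.ofFn_eq_map, List.map_eq_flatMap]
    refine congrArg (List.flatMap · _) (funext fun i => ?_)
    have hi (y : Fin c.1.m) : (∃ f ∈ D, ∃ h, f h = i ∧ f (g * h) = y) ↔ y = φ g i := by
      constructor
      · rintro ⟨f, hf, k, rfl, rfl⟩
        exact (hφ.2 f hf g k).symm
      · rintro rfl
        obtain ⟨f, hf, k, rfl⟩ := h i
        exact ⟨f, hf, k, rfl, (hφ.2 f hf g k).symm⟩
    exact List.perm_singleton.1 ((List.perm_ext_iff_of_nodup (nodup_elems.filter _)
      (List.nodup_singleton _)).2 fun y => by simp [mem_elems, hi])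
  have hperm (σ : Perm (Fin c.1.m)) : code (List.ofFn σ) = Instance.encodePerm σ :=
    congrArg BTree.ofList (List.map_ofFn (f := σ) (g := code))
  refine congrArg BTree.ofList ?_
  simp only [values, key]
  rw [List.map_map, BInst.gens]
  refine List.map_map.trans (List.map_congr_left fun g _ => ?_)
  exact hperm _

namespace PolyTime

variable {Γ : Type} {e : Γ → BTree} {r : Γ → BInst B} {D : ∀ c, State (r c)}

theorem done (hE : PolyTime e fun c => (r c).1.encode) (hD : PolyTime e fun c => code (D c)) :
    PolyTime e fun c => code (Done (D c)) :=
  forallElem (elems_fin (codegree hE)) (cov (wk hE) (wk hD) v0)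

theorem childStates (hE : PolyTime e fun c => (r c).1.encode)
    (hD : PolyTime e fun c => code (D c)) :
    PolyTime e fun c => code (childStates (r c) (D c)) :=
  map (f := fun c f => f :: D c) (filter (elems_maps hE) (isChild (wk hE) (wk hD) v0))
    (cons v0 (wk hD))

theorem values (hE : PolyTime e fun c => (r c).1.encode) (hD : PolyTime e fun c => code (D c)) :
    PolyTime e fun c => code (values (r c) (D c)) :=
  map (gens hE) (flatMap (elems_fin (codegree (wk hE))) (filter (elems_fin (codegree (wk (wk hE))))
    (existsMem (wk (wk (wk hD))) (existsElem (elems_dom (wk (wk (wk (wk hE)))))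
      (and (eq (apply v1 v0) v3) (eq (apply v1 (mul v4 v0)) v2))))))

end PolyTime

/-! ### The search problem -/

open Classical in
/-- Go to the first child if a point remains. -/
noncomputable def descend (c : BInst B) (D : State c) : State c :=
  if Done D then D else (childStates c D).headD D

/-- Descent by as many levels as there are remaining points ends at a complete partial solution. -/
theorem foldl_descend {c : BInst B} {β : Type} (l : List β) {D : State c} (hD : Valid c.graph D)
    (hV : Viable c.graph D) (hl : numRest D ≤ l.length) :
    Valid c.graph (l.foldl (fun D _ => descend c D) D) ∧
      Viable c.graph (l.foldl (fun D _ => descend c D) D) ∧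
      Done (l.foldl (fun D _ => descend c D) D) := by
  induction l generalizing D with
  | nil =>
    refine ⟨hD, hV, fun x => ?_⟩
    by_contra hx
    have : Nonempty {x // ¬ Cov D x} := ⟨x, hx⟩
    have : 0 < numRest D := Nat.card_pos
    simp only [List.length_nil] at hl
    omega
  | cons b l ih =>
    rw [List.foldl_cons, descend]
    split_ifs with h
    · refine ih hD hV (le_of_eq_of_le ?_ (Nat.zero_le _))
      have : IsEmpty {x // ¬ Cov D x} := ⟨fun x => x.2 (h x.1)⟩
      exact Nat.card_of_isEmpty
    · obtain ⟨D', t, hD'⟩ := List.exists_cons_of_ne_nil (childStates_ne_nil hD hV h)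
      obtain ⟨f, hf, rfl⟩ := mem_childStates.1 (hD' ▸ List.mem_cons_self)
      rw [hD', List.headD_cons]
      refine ih (hf.valid hD) hf.2.2.2.2 ?_
      have := hf.numRest_lt
      rw [List.length_cons] at hl
      omega

theorem numRest_le {c : BInst B} (D : State c) : numRest D ≤ c.1.m :=
  (Finite.card_subtype_le _).trans_eq (Nat.card_fin _)

open Classical in
/-- The answer to the search problem, as a list with at most one entry. -/
noncomputable def search (c : BInst B) : List (List (List (Fin c.1.m))) :=
  if Viable c.graph [] then
    [values c ((List.finRange c.1.m).foldl (fun D _ => descend c D) [])]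
  else []

theorem mem_sols_nil_iff (c : BInst B) (φ : Dom c →* Perm (Fin c.1.m)) :
    φ ∈ Sols c.graph [] ↔ toHom φ ∈ c.1.solutions := c.mem_solutions φ

theorem sols_mono_nil {c : BInst B} {D : State c} {φ : Dom c →* Perm (Fin c.1.m)}
    (hφ : φ ∈ Sols c.graph D) : φ ∈ Sols c.graph [] := ⟨hφ.1, by simp⟩

theorem search_spec (c : BInst B) : (c.1.solutions = ∅ ∧ code (search c) = .nil) ∨
    ∃ φ ∈ c.1.solutions, code (search c) = .node (c.1.encodeHom φ) .nil := by
  by_cases h : Viable c.graph []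
  · right
    obtain ⟨hD, hV, hdone⟩ := foldl_descend (List.finRange c.1.m) valid_nil h
      (by rw [List.length_finRange]; exact numRest_le _)
    obtain ⟨φ, hφ⟩ := exists_mem_sols hD hV
    refine ⟨toHom φ, (mem_sols_nil_iff c φ).1 (sols_mono_nil hφ), ?_⟩
    rw [search, if_pos h, code_cons, code_values hdone hφ, code_nil]
  · left
    refine ⟨Set.eq_empty_of_forall_notMem fun φ hφ => h ?_, by rw [search, if_neg h, code_nil]⟩
    exact viable_of_mem_sols ((mem_sols_nil_iff c φ).2 hφ)

/-- The code of a map to the points is polynomially bounded in the size of the instance. -/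
theorem exists_size_code_map_le (B : ℕ) : ∃ q : Polynomial ℕ, ∀ (c : BInst B)
    (f : Dom c → Fin c.1.m), (code f).size ≤ q.eval c.1.encode.size := by
  obtain ⟨q, hq⟩ := (PolyTime.elems_maps (PolyTime.id fun c : BInst B => c.1.encode)).bound
  exact ⟨q, fun c f => (size_code_lt_of_mem (mem_elems f)).le.trans (hq c)⟩

theorem polyTime_search (B : ℕ) :
    PolyTime (fun c : BInst B => c.1.encode) fun c => code (search c) := by
  classical
  have hE := PolyTime.id fun c : BInst B => c.1.encode
  obtain ⟨q, hq⟩ := exists_size_code_map_le B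
  have hfold : PolyTime (fun c : BInst B => c.1.encode)
      fun c => code ((List.finRange c.1.m).foldl (fun D _ => descend c D) []) := by
    refine PolyTime.foldl (σ := fun c => State c) (β := fun c => Fin c.1.m) (s := fun _ => [])
      (step := fun c D _ => descend c D)
      (PolyTime.elems_fin (k := fun c : BInst B => c.1.m) (PolyTime.codegree hE)) PolyTime.nil
      ?_ ⟨q + 1, fun c D b _ => ?_⟩
    · have hE' : PolyTime (ext (ext (fun c : BInst B => c.1.encode) fun c => State c)
          fun p => Fin p.1.1.m) fun p => p.1.1.1.encode := PolyTime.wk (PolyTime.wk hE)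
      refine (PolyTime.ite (PolyTime.done hE' PolyTime.v1) PolyTime.v1 (PolyTime.ite
        (PolyTime.ne_nil (PolyTime.childStates hE' PolyTime.v1))
        (PolyTime.left (PolyTime.childStates hE' PolyTime.v1)) PolyTime.v1)).of_eq fun p => ?_
      rw [descend]
      split_ifs with h₁ h₂
      · rfl
      · obtain ⟨D', t, hD'⟩ := List.exists_cons_of_ne_nil h₂
        rw [hD']
        rfl
      · rw [not_not.1 h₂]
        rfl
    · rw [descend]
      split_ifs with h
      · exact Nat.le_add_right _ _
      · cases hl : childStates c D with
        | nil => exact Nat.le_add_right _ _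
        | cons D' t =>
          obtain ⟨f, hf, rfl⟩ := mem_childStates.1 (hl ▸ List.mem_cons_self)
          have := (hq c f).trans (eval_mono q (Nat.le_add_right _ (code b).size))
          rw [List.headD_cons, code_cons, BTree.size_node]
          simp only [Polynomial.eval_add, Polynomial.eval_one] at this ⊢
          omega
  refine (PolyTime.ite (PolyTime.viable (D := fun _ => []) hE PolyTime.nil)
    (PolyTime.singleton (PolyTime.values hE hfold)) PolyTime.nil).of_eq fun c => ?_
  rw [search, apply_ite code]
  rfl

/-! ### Gaps between outputs -/

/-- If `i` steps without output have been made before the run recorded by the trace, then at no time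
more than `K` consecutive steps without output have been made, and `j` is the number of such steps
at the end. -/
def Paced (K : ℕ) : ℕ → List (Option BTree) → ℕ → Prop
  | i, [], j => i ≤ K ∧ i = j
  | i, none :: t, j => i ≤ K ∧ Paced K (i + 1) t j
  | i, some _ :: t, j => i ≤ K ∧ Paced K 0 t j

theorem Paced.append {K i j k : ℕ} {s t : List (Option BTree)} (hs : Paced K i s j)
    (ht : Paced K j t k) : Paced K i (s ++ t) k := by
  induction s generalizing i with
  | nil => exact hs.2 ▸ ht
  | cons a s ih => cases a <;> exact ⟨hs.1, ih hs.2⟩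

theorem Paced.replicate {K i k : ℕ} (h : i + k ≤ K) :
    Paced K i (List.replicate k none) (i + k) := by
  induction k generalizing i with
  | zero => exact ⟨h, rfl⟩
  | succ k ih =>
    have := ih (i := i + 1) (by omega)
    rw [List.replicate_succ]
    exact ⟨by omega, by rwa [show i + (k + 1) = i + 1 + k by omega]⟩

theorem Paced.emit {K i k l : ℕ} (v : BTree) (h : i + k ≤ K) (hl : l ≤ K) :
    Paced K i (List.replicate k none ++ some v :: List.replicate l none) l := by
  refine (Paced.replicate h).append ⟨h, ?_⟩
  have := Paced.replicate (i := 0) (k := l) (K := K) (by omega)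
  rwa [Nat.zero_add] at this

theorem Paced.add_le_of_prefix {K i j k : ℕ} {t : List (Option BTree)} (h : Paced K i t j)
    (hk : List.replicate k none <+: t) : i + k ≤ K := by
  induction t generalizing i k with
  | nil =>
    rw [List.prefix_nil, List.replicate_eq_nil_iff] at hk
    exact hk ▸ h.1
  | cons a t ih =>
    cases k with
    | zero => cases a <;> exact h.1
    | succ k =>
      rw [List.replicate_succ, List.cons_prefix_cons] at hk
      obtain ⟨rfl, hk⟩ := hk
      have := ih h.2 hk
      omega

theorem Paced.le_of_infix {K i j k : ℕ} {t : List (Option BTree)} (h : Paced K i t j)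
    (hk : List.replicate k none <:+: t) : k ≤ K := by
  induction t generalizing i with
  | nil => exact (Nat.le_add_left _ _).trans (h.add_le_of_prefix (List.prefix_nil.2
      (List.infix_nil.1 hk)))
  | cons a t ih =>
    rcases List.infix_cons_iff.1 hk with hk' | hk'
    · exact (Nat.le_add_left _ _).trans (h.add_le_of_prefix hk')
    · cases a <;> exact ih h.2 hk'

/-- The program `P` makes `k` steps on `x`, writes `v` to the output, makes `l` more steps and
returns `y`. -/
def RunsEmit (P : Prog) (x : BTree) (k : ℕ) (v : BTree) (l : ℕ) (y : BTree) : Prop :=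
  Runs P x (List.replicate k none ++ some v :: List.replicate l none) y

namespace RunsEmit

theorem emit (x : BTree) : RunsEmit .emit x 0 x 0 x := Runs.emit x

theorem seq_right {p q : Prog} {x y z v : BTree} {k l j : ℕ} (h : RunsIn p x k y)
    (h' : RunsEmit q y l v j z) : RunsEmit (.seq p q) x (k + l + 1) v j z := by
  have := Runs.seq h h'
  rwa [← List.append_assoc, ← List.replicate_add, ← List.cons_append,
    ← List.replicate_succ] at this

theorem seq_left {p q : Prog} {x y z v : BTree} {k l j : ℕ} (h : RunsEmit p x k v l y)
    (h' : RunsIn q y j z) : RunsEmit (.seq p q) x (k + 1) v (l + j) z := by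
  have := Runs.seq h h'
  rwa [List.append_assoc, List.cons_append, ← List.replicate_add, ← List.cons_append,
    ← List.replicate_succ] at this

theorem pair_right {p q : Prog} {x y z v : BTree} {k l j : ℕ} (h : RunsIn p x k y)
    (h' : RunsEmit q x l v j z) : RunsEmit (.pair p q) x (k + l + 1) v j (.node y z) := by
  have := Runs.pair h h'
  rwa [← List.append_assoc, ← List.replicate_add, ← List.cons_append,
    ← List.replicate_succ] at this

theorem pair_left {p q : Prog} {x y z v : BTree} {k l j : ℕ} (h : RunsEmit p x k v l y)
    (h' : RunsIn q x j z) : RunsEmit (.pair p q) x (k + 1) v (l + j) (.node y z) := by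
  have := Runs.pair h h'
  rwa [List.append_assoc, List.cons_append, ← List.replicate_add, ← List.cons_append,
    ← List.replicate_succ] at this

theorem ite_node {c p q : Prog} {x a b y v : BTree} {k l j : ℕ} (h : RunsIn c x k (.node a b))
    (h' : RunsEmit p x l v j y) : RunsEmit (.ite c p q) x (k + l + 1) v j y := by
  have := Runs.ite_node (q := q) h h'
  rwa [← List.append_assoc, ← List.replicate_add, ← List.cons_append,
    ← List.replicate_succ] at this

theorem loop_step {c p : Prog} {x a b y z v : BTree} {k l j : ℕ} {u : List (Option BTree)}
    (h : RunsIn c x k (.node a b)) (h' : RunsEmit p x l v j y) (h'' : Runs (.loop c p) y u z) :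
    Runs (.loop c p) x (List.replicate (k + l + 1) none ++ some v :: (List.replicate j none ++ u))
      z := by
  have := Runs.loop_step h h' h''
  rwa [List.append_assoc, List.cons_append, ← List.append_assoc, ← List.replicate_add,
    ← List.cons_append, ← List.replicate_succ] at this

end RunsEmit

/-! ### Depth-first search with a stack -/

/-- The stack with the entries of a list put on top, one after the other. -/
def push {α : Type} [Coded α] (l : List α) (s : BTree) : BTree :=
  l.foldl (fun s a => .node (code a) s) s

/-- On `node (code l) s`, return `push l s`. -/
def pushProg : Prog :=
  .seq (.loop .left (.pair (.seq .left .right) (.pair (.seq .left .left) .right))) .right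

/-- The number of steps does not depend on the size of the stack. -/
theorem pushProg_run {α : Type} [Coded α] (l : List α) (s : BTree) :
    RunsIn pushProg (.node (code l) s) (11 * l.length + 4) (push l s) := by
  have key : RunsIn (.loop .left (.pair (.seq .left .right) (.pair (.seq .left .left) .right)))
      (.node (code l) s) (11 * l.length + 2) (.node .nil (push l s)) := by
    induction l generalizing s with
    | nil => exact .loop_nil (.left _)
    | cons a l ih =>
      exact (RunsIn.loop_step (a := code a) (b := code l) (.left _)
        (.pair ((RunsIn.left _).seq (.right _)) (.pair ((RunsIn.left _).seq (.left _)) (.right _)))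
        (ih _)).congr (by rw [List.length_cons]; ring)
  exact key.seq (.right _)

/-- The program `P` for the first entry of the stack. The state is a node whose left subtree is the
code of the instance and whose right subtree is the stack. -/
def onTop (P : Prog) : Prog := .seq (.pair .left (.seq .right .left)) P

theorem onTop_run {P : Prog} {x D s y : BTree} {k : ℕ} (h : RunsIn P (.node x D) k y) :
    RunsIn (onTop P) (.node x (.node D s)) (k + 6) y :=
  (((RunsIn.left _).pair ((RunsIn.right _).seq (.left _))).seq h).congr (by omega)

/-- One round of the search. If the top entry of the stack is complete, which is tested by `C`, it
is replaced by nothing, and its values, which are computed by `V`, are written to the output.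
Otherwise it is replaced by its children, which are computed by `S`. -/
def dfsBody (C V S : Prog) : Prog :=
  .pair .left (.ite (onTop C)
    (.seq (.pair (.seq (onTop V) .emit) (.seq .right .right)) .right)
    (.seq (.pair (onTop S) (.seq .right .right)) pushProg))

/-- The search: a loop that ends when the stack is empty. -/
def dfsLoop (C V S : Prog) : Prog := .loop .right (dfsBody C V S)

/-- The bounds on the programs that are used in one round of the search. -/
structure DfsSpec (C V S : Prog) (c : BInst B) (T : ℕ) : Prop where
  done : ∀ D : State c, Valid c.graph D → ∃ k ≤ T,
    RunsIn C (.node c.1.encode (code D)) k (code (Done D))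
  values : ∀ D : State c, Valid c.graph D → ∃ k ≤ T,
    RunsIn V (.node c.1.encode (code D)) k (code (values c D))
  childStates : ∀ D : State c, Valid c.graph D → ∃ k,
    RunsIn S (.node c.1.encode (code D)) k (code (childStates c D)) ∧
      k + 12 * (childStates c D).length ≤ T

variable {C V S : Prog} {c : BInst B} {T : ℕ}

theorem DfsSpec.loop_step_done (h : DfsSpec C V S c T) {D : State c} (hD : Valid c.graph D)
    (hd : Done D) : ∃ k l, k ≤ 2 * T + 100 ∧ l ≤ 2 * T + 100 ∧ ∀ s u z,
      Runs (dfsLoop C V S) (.node c.1.encode s) u z →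
      Runs (dfsLoop C V S) (.node c.1.encode (.node (code D) s)) (List.replicate k none ++
        some (code (HomExt.values c D)) :: (List.replicate l none ++ u)) z := by
  obtain ⟨i, hi, hC⟩ := h.done D hD
  obtain ⟨j, hj, hV⟩ := h.values D hD
  rw [eq_true hd, PolyTime.code_true] at hC
  refine ⟨1 + (1 + (i + 6 + (j + 6 + 0 + 1 + 1 + 1) + 1) + 1) + 1, 0 + (1 + 1 + 1) + 1, by omega,
    by omega, fun s u z hu => ?_⟩
  have rest := (RunsIn.right (.node c.1.encode (.node (code D) s))).seq (.right _)
  have write := RunsEmit.seq_right (onTop_run (s := s) hV) (RunsEmit.emit _)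
  have body := RunsEmit.pair_right (RunsIn.left _) (.ite_node
    (q := .seq (.pair (onTop S) (.seq .right .right)) pushProg) (onTop_run hC)
    ((write.pair_left rest).seq_left (.right _)))
  exact RunsEmit.loop_step (c := .right) (a := code D) (b := s) (.right _) body hu

theorem DfsSpec.loop_step_not_done (h : DfsSpec C V S c T) {D : State c} (hD : Valid c.graph D)
    (hd : ¬ Done D) : ∃ k ≤ 2 * T + 100, ∀ s u z,
      Runs (dfsLoop C V S) (.node c.1.encode (push (HomExt.childStates c D) s)) u z →
      Runs (dfsLoop C V S) (.node c.1.encode (.node (code D) s)) (List.replicate k none ++ u)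
        z := by
  obtain ⟨i, hi, hC⟩ := h.done D hD
  obtain ⟨j, hS, hj⟩ := h.childStates D hD
  rw [eq_false hd, PolyTime.code_false] at hC
  set n := 11 * (HomExt.childStates c D).length + 4 with hn
  refine ⟨1 + (1 + (i + 6 + (j + 6 + (1 + 1 + 1) + 1 + n + 1) + 1) + 1) + 1, by omega,
    fun s u z hu => ?_⟩
  have rest := (RunsIn.right (.node c.1.encode (.node (code D) s))).seq (.right _)
  have body := (RunsIn.left (.node c.1.encode (.node (code D) s))).pair (.ite_nil
    (p := .seq (.pair (.seq (onTop V) .emit) (.seq .right .right)) .right) (onTop_run hC)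
    (((onTop_run hS).pair rest).seq (pushProg_run (HomExt.childStates c D) s)))
  have := Runs.loop_step (c := .right) (a := code D) (b := s) (.right _) body hu
  rwa [← List.append_assoc, ← List.singleton_append, ← List.append_assoc,
    show [none] = List.replicate 1 (none : Option BTree) from rfl,
    ← List.replicate_add, ← List.replicate_add, Nat.add_comm] at this

/-- A complete partial solution has one completion, which is written in a single round. -/
theorem DfsSpec.exists_trace_of_done (h : DfsSpec C V S c T) {K : ℕ} {D : State c}
    (hD : Valid c.graph D) (hV : Viable c.graph D) (hd : Done D) :
    ∃ (tr : List (Option BTree)) (l : List (Dom c →* Perm (Fin c.1.m))),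
      l.Nodup ∧ (∀ φ, φ ∈ l ↔ φ ∈ Sols c.graph D) ∧
      tr.reduceOption = l.map (fun φ => c.1.encodeHom (toHom φ)) ∧
      (∀ i, i + (2 * T + 100) ≤ K → ∃ j ≤ 2 * T + 100, Paced K i tr j) ∧
      ∀ s u z, Runs (dfsLoop C V S) (.node c.1.encode s) u z →
        Runs (dfsLoop C V S) (.node c.1.encode (.node (code D) s)) (tr ++ u) z := by
  obtain ⟨k, j, hk, hj, hrun⟩ := h.loop_step_done hD hd
  obtain ⟨φ, hφ⟩ := exists_mem_sols hD hV
  refine ⟨_, [φ], List.nodup_singleton _, fun φ' => ?_, ?_, fun i hi => ⟨j, hj, Paced.emit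
    (k := k) (code (HomExt.values c D)) (by omega) (by omega)⟩, fun s u z hu => ?_⟩
  · rw [List.mem_singleton]
    exact ⟨fun h => h ▸ hφ, fun h => sols_subsingleton hd h hφ⟩
  · rw [List.reduceOption_append, List.reduceOption_replicate_none,
      List.reduceOption_cons_of_some, List.reduceOption_replicate_none, code_values hd hφ]
    rfl
  · rw [List.append_assoc, List.cons_append]
    exact hrun s u z hu

/-- The search below a viable partial solution writes the codes of its completions. A run without
output leads from a partial solution to its last child, and so on to a complete one; its length is
bounded by the number of remaining points, as each viable partial solution has a completion. The
steps after the last output belong to the round of that output. -/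
theorem DfsSpec.exists_trace (h : DfsSpec C V S c T) {K r : ℕ} {D : State c}
    (hD : Valid c.graph D) (hV : Viable c.graph D) (hr : numRest D ≤ r) :
    ∃ (tr : List (Option BTree)) (l : List (Dom c →* Perm (Fin c.1.m))),
      l.Nodup ∧ (∀ φ, φ ∈ l ↔ φ ∈ Sols c.graph D) ∧
      tr.reduceOption = l.map (fun φ => c.1.encodeHom (toHom φ)) ∧
      (∀ i, i + (r + 1) * (2 * T + 100) ≤ K → ∃ j ≤ 2 * T + 100, Paced K i tr j) ∧
      ∀ s u z, Runs (dfsLoop C V S) (.node c.1.encode s) u z →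
        Runs (dfsLoop C V S) (.node c.1.encode (.node (code D) s)) (tr ++ u) z := by
  set N := 2 * T + 100 with hN
  induction r generalizing D with
  | zero =>
    by_cases hd : Done D
    · simpa only [Nat.zero_add, Nat.one_mul] using h.exists_trace_of_done (K := K) hD hV hd
    · obtain ⟨D', t, hD'⟩ := List.exists_cons_of_ne_nil (childStates_ne_nil hD hV hd)
      obtain ⟨f, hf, rfl⟩ := mem_childStates.1 (hD' ▸ List.mem_cons_self)
      exact absurd (hf.numRest_lt) (by omega)
  | succ r ih =>
    by_cases hd : Done D
    · obtain ⟨tr, l, h₁, h₂, h₃, h₄, h₅⟩ := h.exists_trace_of_done (K := K) hD hV hd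
      refine ⟨tr, l, h₁, h₂, h₃, fun i hi => h₄ i (le_trans ?_ hi), h₅⟩
      exact Nat.add_le_add_left (Nat.le_mul_of_pos_left _ (Nat.succ_pos _)) _
    have key (ls : List (State c)) (hls : ls.Nodup)
        (hsub : ∀ D' ∈ ls, ∃ f, IsChild c.graph D f ∧ D' = f :: D) :
        ∃ (tr : List (Option BTree)) (l : List (Dom c →* Perm (Fin c.1.m))),
          l.Nodup ∧ (∀ φ, φ ∈ l ↔ ∃ D' ∈ ls, φ ∈ Sols c.graph D') ∧
          tr.reduceOption = l.map (fun φ => c.1.encodeHom (toHom φ)) ∧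
          (∀ i, i + (r + 1) * N ≤ K → N + (r + 1) * N ≤ K →
            ∃ j, (j ≤ N ∨ ls = [] ∧ j = i) ∧ Paced K i tr j) ∧
          ∀ s u z, Runs (dfsLoop C V S) (.node c.1.encode s) u z →
            Runs (dfsLoop C V S) (.node c.1.encode (push ls s)) (tr ++ u) z := by
      induction ls with
      | nil => exact ⟨[], [], List.nodup_nil, by simp, rfl,
          fun i hi _ => ⟨i, .inr ⟨rfl, rfl⟩, by omega, rfl⟩, fun s u z hu => hu⟩
      | cons D' ls ihls =>
        obtain ⟨hnot, hls⟩ := List.nodup_cons.1 hls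
        obtain ⟨tr, l, h₁, h₂, h₃, h₄, h₅⟩ := ihls hls fun D'' h =>
          hsub D'' (List.mem_cons_of_mem _ h)
        obtain ⟨f, hf, hfD⟩ := hsub D' List.mem_cons_self
        obtain ⟨tr', l', h₁', h₂', h₃', h₄', h₅'⟩ := ih (D := D') (hfD ▸ hf.valid hD)
          (hfD ▸ hf.2.2.2.2) (by have := hf.numRest_lt; rw [hfD]; omega)
        refine ⟨tr ++ tr', l ++ l', h₁.append h₁' fun φ hφ hφ' => ?_, fun φ => ?_, ?_,
          fun i hi hi' => ?_, fun s u z hu => ?_⟩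
        · obtain ⟨D'', hD'', hφ⟩ := (h₂ φ).1 hφ
          obtain ⟨f', hf', rfl⟩ := hsub D'' (List.mem_cons_of_mem _ hD'')
          have hφ' := (h₂' φ).1 hφ'
          rw [hfD] at hφ' hnot
          rw [hf.unique hf' hφ' hφ] at hnot
          exact hnot hD''
        · rw [List.mem_append, h₂, h₂', List.exists_mem_cons_iff, or_comm]
        · rw [List.reduceOption_append, h₃, h₃', List.map_append]
        · obtain ⟨j, hj, hpace⟩ := h₄ i hi hi'
          obtain ⟨j', hj', hpace'⟩ := h₄' j (by omega)
          exact ⟨j', .inl hj', hpace.append hpace'⟩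
        · rw [List.append_assoc]
          exact h₅ _ _ _ (h₅' s u z hu)
    obtain ⟨k, hk, hrun⟩ := h.loop_step_not_done hD hd
    obtain ⟨tr, l, h₁, h₂, h₃, h₄, h₅⟩ := key _ (nodup_childStates c D)
      fun D' hD' => mem_childStates.1 hD'
    refine ⟨List.replicate k none ++ tr, l, h₁, fun φ => (h₂ φ).trans ⟨?_, fun hφ => ?_⟩, ?_,
      fun i hi => ?_, fun s u z hu => ?_⟩
    · rintro ⟨D', hD', hφ⟩
      obtain ⟨f, hf, rfl⟩ := mem_childStates.1 hD'
      exact sols_cons_subset hφ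
    · obtain ⟨f, hf, hφ'⟩ := exists_isChild hφ (not_done hd)
      exact ⟨_, mem_childStates.2 ⟨f, hf, rfl⟩, hφ'⟩
    · rw [List.reduceOption_append, List.reduceOption_replicate_none, List.nil_append, h₃]
    · rw [Nat.succ_mul (r + 1)] at hi
      obtain ⟨j, hj, hpace⟩ := h₄ (i + k) (by omega) (by omega)
      exact ⟨j, hj.resolve_right fun h => childStates_ne_nil hD hV hd h.1,
        (Paced.replicate (by omega)).append hpace⟩
    · rw [List.append_assoc]
      exact hrun _ _ _ (h₅ s u z hu)

theorem Instance.codegree_le_size_encode (I : Instance) : I.m ≤ I.encode.size := by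
  have : (BTree.ofNat I.m).size = 2 * I.m + 1 := size_code_nat I.m
  simp only [Instance.encode, BTree.ofList, BTree.size_node]
  omega

/-- A partial solution has at most `m` orbits, as they are disjoint. -/
theorem exists_size_code_state_le (B : ℕ) : ∃ q : Polynomial ℕ, ∀ (c : BInst B) (D : State c),
    Valid c.graph D → (code D).size ≤ q.eval c.1.encode.size := by
  obtain ⟨q, hq⟩ := exists_size_code_map_le B
  refine ⟨Polynomial.X * (q + 1) + 1, fun c D hD => ?_⟩
  refine (size_code_list_le D fun f _ => hq c f).trans ?_
  simp only [Polynomial.eval_add, Polynomial.eval_mul, Polynomial.eval_X, Polynomial.eval_one]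
  have := length_add_numRest_le hD
  have := c.1.codegree_le_size_encode
  exact Nat.add_le_add_right (Nat.mul_le_mul_right _ (by omega)) _

theorem exists_dfsSpec (B : ℕ) : ∃ (C V S : Prog) (p : Polynomial ℕ), ∀ c : BInst B,
    DfsSpec C V S c (p.eval c.1.encode.size) := by
  have hE : PolyTime (ext (fun c : BInst B => c.1.encode) fun c => State c) fun p =>
      p.1.1.encode := PolyTime.wk (PolyTime.id _)
  obtain ⟨C, pC, hC⟩ := PolyTime.done hE PolyTime.v0
  obtain ⟨V, pV, hV⟩ := PolyTime.values hE PolyTime.v0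
  obtain ⟨S, pS, hS⟩ := PolyTime.childStates hE PolyTime.v0
  obtain ⟨q, hq⟩ := exists_size_code_state_le B
  have hle (p : Polynomial ℕ) (c : BInst B) {D : State c} (hD : Valid c.graph D) :
      p.eval (ext (fun c : BInst B => c.1.encode) (fun c => State c) ⟨c, D⟩).size ≤
        p.eval (c.1.encode.size + q.eval c.1.encode.size + 1) := by
    refine eval_mono p ?_
    have := hq c D hD
    rw [ext, BTree.size_node]
    dsimp only
    omega
  refine ⟨C, V, S, (pC + pV + 12 * pS).comp (Polynomial.X + q + 1), fun c => ⟨?_, ?_, ?_⟩⟩ <;>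
    intro D hD <;>
    simp only [Polynomial.eval_add, Polynomial.eval_mul, Polynomial.eval_comp, Polynomial.eval_X,
      Polynomial.eval_one, Polynomial.eval_ofNat]
  · obtain ⟨k, hk, hk'⟩ := hC ⟨c, D⟩
    have := hle pC c hD
    exact ⟨k, by omega, hk⟩
  · obtain ⟨k, hk, hk'⟩ := hV ⟨c, D⟩
    have := hle pV c hD
    exact ⟨k, by omega, hk⟩
  · obtain ⟨k, hk, hk'⟩ := hS ⟨c, D⟩
    have := hle pS c hD
    have := length_lt_size_code (childStates c D)
    dsimp only at hk'
    exact ⟨k, hk, by omega⟩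

open Classical in
/-- The stack at the start of the search. It is empty if there is no solution, so that each partial
solution on the stack is viable at all times. -/
noncomputable def initial (c : BInst B) : List (State c) := if Viable c.graph [] then [[]] else []

theorem polyTime_initial (B : ℕ) :
    PolyTime (fun c : BInst B => c.1.encode) fun c => code (initial c) := by
  classical
  refine (PolyTime.ite (PolyTime.viable (D := fun _ => []) (PolyTime.id _) PolyTime.nil)
    (PolyTime.singleton (α := fun c => State c) (a := fun _ => []) PolyTime.nil)
    PolyTime.nil).of_eq fun c => ?_
  rw [initial, apply_ite code]
  rfl

theorem DfsSpec.enumerates {C V S Q : Prog} {c : BInst B} {T K k : ℕ} (h : DfsSpec C V S c T)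
    (hQ : RunsIn Q c.1.encode k (code (initial c)))
    (hK : k + 5 + (c.1.m + 1) * (2 * T + 100) ≤ K) :
    Enumerates (.seq (.pair .skip Q) (dfsLoop C V S)) c.1 K := by
  have hinit := (RunsIn.skip _).pair hQ
  have hnil : RunsIn (dfsLoop C V S) (.node c.1.encode .nil) (1 + 1) (.node c.1.encode .nil) :=
    .loop_nil (.right _)
  by_cases hV : Viable c.graph []
  · obtain ⟨tr, l, h₁, h₂, h₃, h₄, h₅⟩ := h.exists_trace (K := K) valid_nil hV (numRest_le _)
    rw [initial, if_pos hV] at hinit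
    refine ⟨_, _, Runs.seq hinit (h₅ .nil _ _ hnil), ⟨l.map toHom, h₁.map fun _ _ h => h,
      fun φ => ?_, ?_⟩, fun i hi => ?_⟩
    · rw [List.mem_map]
      constructor
      · rintro ⟨φ, hφ, rfl⟩
        exact (mem_sols_nil_iff c φ).1 ((h₂ φ).1 hφ)
      · exact fun hφ => ⟨φ, (h₂ φ).2 ((mem_sols_nil_iff c φ).2 hφ), rfl⟩
    · rw [List.reduceOption_cons_of_none, List.reduceOption_append, List.reduceOption_append,
        List.reduceOption_replicate_none, List.reduceOption_replicate_none, List.nil_append,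
        List.append_nil, h₃, List.map_map]
      rfl
    · rw [← List.cons_append, ← List.replicate_succ] at hi
      obtain ⟨j, hj, hpace⟩ := h₄ (0 + (1 + k + 1 + 1)) (by omega)
      have hN : 2 * T + 100 ≤ (c.1.m + 1) * (2 * T + 100) :=
        Nat.le_mul_of_pos_left _ (Nat.succ_pos _)
      exact ((Paced.replicate (by omega)).append (hpace.append
        (Paced.replicate (by omega)))).le_of_infix hi
  · rw [initial, if_neg hV] at hinit
    refine ⟨_, _, hinit.seq hnil, ⟨[], List.nodup_nil, fun φ => ?_, ?_⟩, fun i hi => ?_⟩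
    · simp only [List.not_mem_nil, false_iff]
      exact fun hφ => hV (viable_of_mem_sols ((mem_sols_nil_iff c φ).2 hφ))
    · rw [List.reduceOption_replicate_none, List.map_nil]
    · exact ((Paced.replicate (K := K) (i := 0) (by omega)).le_of_infix hi)

/-! ### The size of the input -/

theorem size_encodePerm_le {k N : ℕ} (hk : k ≤ N) (σ : Perm (Fin k)) :
    (Instance.encodePerm σ).size ≤ N * (2 * N + 2) + 1 := by
  have h : Instance.encodePerm σ = code (List.ofFn σ) :=
    (congrArg BTree.ofList (List.map_ofFn (f := σ) (g := code))).symm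
  rw [h]
  refine (size_code_list_le (N := 2 * N + 1) _ fun i _ => ?_).trans ?_
  · have : (code i).size = 2 * i.1 + 1 := size_code_nat i.1
    omega
  · rw [List.length_ofFn]
    exact Nat.add_le_add_right (Nat.mul_le_mul_right _ hk) _

theorem exists_size_encode_le :
    ∃ s : Polynomial ℕ, ∀ I : Instance, I.encode.size ≤ s.eval I.size := by
  set A : Polynomial ℕ := Polynomial.X * (2 * Polynomial.X + 2) + 1 with hA
  refine ⟨4 * Polynomial.X + Polynomial.X * (A + 1) + Polynomial.X * (2 * A + 1 + 1) + 20,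
    fun I => ?_⟩
  set N := I.size with hN
  have hAN : A.eval N = N * (2 * N + 2) + 1 := by simp [hA]
  have hsize : I.n + I.m + I.gens.length + I.graph.length = N := rfl
  have hn : (BTree.ofNat I.n).size = 2 * I.n + 1 := size_code_nat I.n
  have hm : (BTree.ofNat I.m).size = 2 * I.m + 1 := size_code_nat I.m
  have hg : (code I.gens).size ≤ N * (A.eval N + 1) + 1 :=
    (size_code_list_le _ fun σ _ => (size_encodePerm_le (by omega) σ).trans_eq hAN.symm).trans
      (Nat.add_le_add_right (Nat.mul_le_mul_right _ (by omega)) _)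
  have hp : (code I.graph).size ≤ N * (2 * A.eval N + 1 + 1) + 1 := by
    refine (size_code_list_le (N := 2 * A.eval N + 1) _ fun p _ => ?_).trans
      (Nat.add_le_add_right (Nat.mul_le_mul_right _ (by omega)) _)
    have h₁ : (Instance.encodePerm p.1).size ≤ A.eval N :=
      (size_encodePerm_le (by omega) _).trans_eq hAN.symm
    have h₂ : (Instance.encodePerm p.2).size ≤ A.eval N :=
      (size_encodePerm_le (by omega) _).trans_eq hAN.symm
    have : (code p).size = (Instance.encodePerm p.1).size + (Instance.encodePerm p.2).size + 1 :=
      rfl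
    omega
  have h : I.encode.size = (BTree.ofNat I.n).size + ((BTree.ofNat I.m).size +
      ((code I.gens).size + ((code I.graph).size + 1 + 1) + 1) + 1) + 1 := rfl
  simp only [Polynomial.eval_add, Polynomial.eval_mul, Polynomial.eval_X, Polynomial.eval_one,
    Polynomial.eval_ofNat]
  omega

/-! ### The number of subgroups -/

theorem card_conjLE_le (G : Type*) [Group G] [Finite G] (m : ℕ) :
    Nat.card (ConjLE G m) ≤ 2 ^ Nat.card G := by
  have : Fintype G := Fintype.ofFinite G
  calc Nat.card (ConjLE G m) ≤ Nat.card {L : Subgroup G // L.index ≤ m} :=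
        Nat.card_le_card_of_surjective _ Quotient.mk_surjective
    _ ≤ Nat.card (Subgroup G) := Finite.card_subtype_le _
    _ ≤ Nat.card (Set G) := Nat.card_le_card_of_injective _ SetLike.coe_injective
    _ = 2 ^ Nat.card G := by rw [Nat.card_eq_fintype_card, Fintype.card_set,
      Nat.card_eq_fintype_card]

end HomExt


theorem mainTheorem9 (B : ℕ) :
    (∃ (P : HomExt.Prog) (p : Polynomial ℕ), ∀ I : HomExt.Instance,
      Nat.card I.G ≤ B → HomExt.SolvesSearch P I (p.eval I.size)) ∧
    (∃ (P : HomExt.Prog) (p : Polynomial ℕ), ∀ I : HomExt.Instance,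
      Nat.card I.G ≤ B → HomExt.Enumerates P I (p.eval I.size)) ∧
    (∃ N : ℕ, ∀ (n m : ℕ) (G : Subgroup (Equiv.Perm (Fin n))) (M : Subgroup G)
      (ψ : M →* Equiv.Perm (Fin m)), Nat.card G ≤ B →
        (HomExt.oms ψ).numVariables ≤ N ∧ (HomExt.oms ψ).numConstraints ≤ N) := by
  obtain ⟨s, hs⟩ := HomExt.exists_size_encode_le
  refine ⟨?_, ?_, 2 ^ B, fun n m G M ψ hB => ⟨?_, ?_⟩⟩
  · obtain ⟨P, p, hP⟩ := HomExt.polyTime_search B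
    refine ⟨P, p.comp s, fun I hI => ?_⟩
    obtain ⟨k, hk, hk'⟩ := hP ⟨I, hI⟩
    refine ⟨_, _, hk, ?_, HomExt.search_spec ⟨I, hI⟩⟩
    rw [List.length_replicate, Polynomial.eval_comp]
    exact ((Nat.le_add_right _ _).trans hk').trans (HomExt.eval_mono p (hs I))
  · obtain ⟨C, V, S, p, hp⟩ := HomExt.exists_dfsSpec B
    obtain ⟨Q, q, hQ⟩ := HomExt.polyTime_initial B
    refine ⟨.seq (.pair .skip Q) (HomExt.dfsLoop C V S),
      (q + 5 + (Polynomial.X + 1) * (2 * p + 100)).comp s, fun I hI => ?_⟩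
    obtain ⟨k, hk, hk'⟩ := hQ ⟨I, hI⟩
    refine (hp ⟨I, hI⟩).enumerates hk ((?_ : _ ≤ Polynomial.eval I.encode.size
      (q + 5 + (Polynomial.X + 1) * (2 * p + 100))).trans ?_)
    · simp only [Polynomial.eval_add, Polynomial.eval_mul, Polynomial.eval_X, Polynomial.eval_one,
        Polynomial.eval_ofNat]
      exact Nat.add_le_add (Nat.add_le_add_right ((Nat.le_add_right _ _).trans hk') _)
        (Nat.mul_le_mul_right _ (Nat.add_le_add_right I.codegree_le_size_encode _))
    · rw [Polynomial.eval_comp]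
      exact HomExt.eval_mono _ (hs I)
  · exact (HomExt.card_conjLE_le G m).trans (Nat.pow_le_pow_right (by norm_num) hB)
  · exact (HomExt.card_conjLE_le M m).trans (Nat.pow_le_pow_right (by norm_num)
      ((Subgroup.card_le_card_group M).trans hB))
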